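/- Conventions. A graph $\Gamma$ is a 1-dimensional cell complex, described by its set $V\Gamma$ of vertices and its set $E\Gamma$ of oriented edges, with initial vertices $o(e)$, a fixed-point-free orientation reversal $e\mapsto e^{-1}$, and $t(e)=o(e^{-1})$. An edge-path is a sequence $e_1,\dots,e_n$ of oriented edges with $t(e_i)=o(e_{i+1})$; it is tight if $e_{i+1}\ne e_i^{-1}$ for all $i$. Maps between graphs are taken to be cellular and are recorded by their vertex maps and the edge-paths $f(e)$ that are the images of the edges, with $f(e^{-1})=f(e)^{-1}$; homotopies of maps and homotopy equivalences are understood in terms of edge-paths up to insertion and deletion of backtracks $e,e^{-1}$. A graph-map is a map sending every edge to a tight edge-path of positive length. $R_N$ is the wedge of $N$ circles, with $F_N=\pi_1(R_N)$ the free group of rank $N$. A topological representative of $\varphi\in\mathrm{Out}(F_N)$ consists of a finite connected graph $\Gamma$, a homotopy equivalence $\alpha:R_N\to\Gamma$ and a graph-map $f:\Gamma\to\Gamma$ that is a homotopy equivalence, such that for a homotopy inverse $\beta$ of $\alpha$ the map $\beta\circ f\circ\alpha$ induces $\varphi$ on $F_N=\pi_1(R_N)$. It is a train-track representative if $f$ is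 a train-track map, i.e. $f^n(e)$ is tight for every edge $e$ and every $n\ge 1$, and every vertex of $\Gamma$ has degree at least $3$. It is expanding if there is an edge $e$ such that the length of the edge-path $f^n(e)$ tends to infinity as $n\to\infty$. For $v\in V\Gamma$ the Whitehead graph $Wh_\Gamma(v,f)$ is the simple graph whose vertices are the oriented edges of $\Gamma$ with origin $v$, where two distinct such edges $e',e''$ are adjacent if for some $e\in E\Gamma$ and $n\ge 1$ the edge-path $f^n(e)$ contains $(e')^{-1},e''$ or $(e'')^{-1},e'$ as consecutive edges. An element $\varphi\in\mathrm{Out}(F_N)$ is reducible if there is a free product decomposition $F_N=A_1*\cdots*A_k*C$ with $k\ge 1$, $A_i\ne 1$ and $A_i\ne F_N$ for all $i$, such that $\varphi$ permutes the conjugacy classes $[A_1],\dots,[A_k]$. Proposition. Let $N\ge 2$, let $\varphi\in\mathrm{Out}(F_N)$ and let $f:\Gamma\to\Gamma$ be an expanding train-track representative of $\varphi$. Suppose that there is a vertex $u\in V\Gamma$ such that the Whitehead graph $Wh_\Gamma(u,f)$ is disconnected. Then $\varphi$ is reducible. -/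

import Mathlib

namespace TrainTrack

/-! ### Free groups, outer automorphisms, reducibility -/

/-- The outer automorphism group `Out(G) = Aut(G) / Inn(G)` (as a set of cosets). -/
abbrev Out (G : Type*) [Group G] : Type _ :=
  MulAut G ⧸ (MulAut.conj : G →* MulAut G).range

/-- `G` is the internal free product `A₁ * ⋯ * A_k * C` of its subgroups `A i` and `C`. -/
def IsFreeProduct {G : Type*} [Group G] {k : ℕ} (A : Fin k → Subgroup G) (C : Subgroup G) : Prop :=
  Function.Bijective
    (Monoid.Coprod.lift (Monoid.CoprodI.lift fun i => (A i).subtype) C.subtype)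

/-- `φ ∈ Out(G)` is reducible: there is a free product decomposition `G = A₁ * ⋯ * A_k * C` with
`k ≥ 1`, `A i ≠ 1` and `A i ≠ G`, such that `φ` permutes the conjugacy classes `[A₁], …, [A_k]`. -/
def IsReducible {G : Type*} [Group G] (φ : Out G) : Prop :=
  ∃ (k : ℕ) (A : Fin k → Subgroup G) (C : Subgroup G),
    1 ≤ k ∧ IsFreeProduct A C ∧ (∀ i, A i ≠ ⊥ ∧ A i ≠ ⊤) ∧
    ∃ (Φ : MulAut G) (σ : Equiv.Perm (Fin k)), (QuotientGroup.mk Φ : Out G) = φ ∧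
      ∀ i, ∃ g : G,
        (A i).map Φ.toMonoidHom = (A (σ i)).map (MulAut.conj g).toMonoidHom

/-! ### Graphs and edge-paths -/

/-- A graph (a 1-dimensional cell complex) with vertex set `V` and set of *oriented* edges `E`.
Each topological edge gives exactly two oriented edges `e`, `inv e`. Loops and multiple edges are
allowed; `o e` is the initial vertex of `e`. -/
structure SerreGraph (V : Type*) (E : Type*) where
  o : E → V
  inv : E → E
  inv_inv : ∀ e, inv (inv e) = e
  inv_ne : ∀ e, inv e ≠ e

namespace SerreGraph

variable {V E : Type*} (Γ : SerreGraph V E)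

/-- The terminal vertex of an oriented edge. -/
def t (e : E) : V := Γ.o (Γ.inv e)

/-- `Γ.IsPath u p v`: the list `p` of oriented edges is an edge-path from `u` to `v`
(the empty list is the trivial path at a vertex). -/
def IsPath : V → List E → V → Prop
  | u, [], v => u = v
  | u, e :: p, v => Γ.o e = u ∧ IsPath (Γ.t e) p v

/-- The inverse path `e_n⁻¹, …, e_1⁻¹` of `e_1, …, e_n`. -/
def invPath (p : List E) : List E := (p.map Γ.inv).reverse

/-- A path is tight if no edge in it is directly followed by its inverse. -/
def IsTight (p : List E) : Prop := p.IsChain fun e e' => e' ≠ Γ.inv e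

/-- `Γ` is connected (and non-empty). -/
def IsConnected : Prop := Nonempty V ∧ ∀ u v, ∃ p, Γ.IsPath u p v

/-- The degree of a vertex: the number of oriented edges starting there (a loop counts twice). -/
noncomputable def degree (v : V) : ℕ := Nat.card {e : E // Γ.o e = v}

/-- The turn `e, e'` (oriented edges with a common origin) is contained in the path `p`. -/
def TurnIn (e e' : E) (p : List E) : Prop :=
  [Γ.inv e, e'] <:+: p ∨ [Γ.inv e', e] <:+: p

/-- Insertion of a backtrack `e, e⁻¹` into an edge-path from `u` to `v`. -/
def Backtrack (u v : V) (p q : List E) : Prop :=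
  Γ.IsPath u p v ∧ Γ.IsPath u q v ∧
    ∃ (a b : List E) (e : E), p = a ++ b ∧ q = a ++ e :: Γ.inv e :: b

/-- `p` and `q` are edge-paths from `u` to `v`, homotopic relative to endpoints: they differ by
finitely many insertions and deletions of backtracks. -/
def PathHomotopic (u v : V) (p q : List E) : Prop :=
  Γ.IsPath u p v ∧ Γ.IsPath u q v ∧ Relation.EqvGen (Γ.Backtrack u v) p q

end SerreGraph

/-- The rose `R_N`: one vertex and `N` loops; `(i, true)` is the `i`-th loop with its chosen
orientation, `(i, false)` is its inverse. Edge-paths in `R_N` are thus literally the words in the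
generators of `FreeGroup (Fin N)` and their inverses; this is the identification of `F_N` with the
fundamental group of `R_N`. -/
def rose (N : ℕ) : SerreGraph Unit (Fin N × Bool) where
  o := fun _ => ()
  inv := fun x => (x.1, !x.2)
  inv_inv := fun x => by simp
  inv_ne := fun x => by rcases x with ⟨i, b⟩; cases b <;> simp

/-! ### Maps between graphs and homotopy -/

/-- A cellular map between graphs, recorded by its effect on vertices and by the (possibly trivial,
possibly non-tight) edge-paths that are the images of the oriented edges. -/
structure CellMap {V₁ E₁ V₂ E₂ : Type*} (Γ₁ : SerreGraph V₁ E₁) (Γ₂ : SerreGraph V₂ E₂) where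
  vert : V₁ → V₂
  edge : E₁ → List E₂
  isPath : ∀ e, Γ₂.IsPath (vert (Γ₁.o e)) (edge e) (vert (Γ₁.t e))
  edge_inv : ∀ e, edge (Γ₁.inv e) = Γ₂.invPath (edge e)

namespace SerreGraph

variable {V E : Type*} (Γ : SerreGraph V E)

theorem t_inv (e : E) : Γ.t (Γ.inv e) = Γ.o e := by
  simp [t, Γ.inv_inv]

theorem IsPath.append {p q : List E} {u v w : V} (hp : Γ.IsPath u p v) (hq : Γ.IsPath v q w) :
    Γ.IsPath u (p ++ q) w := by
  induction p generalizing u with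
  | nil => cases hp; exact hq
  | cons e p ih => exact ⟨hp.1, ih hp.2⟩

theorem invPath_append (p q : List E) :
    Γ.invPath (p ++ q) = Γ.invPath q ++ Γ.invPath p := by
  simp [invPath]

end SerreGraph

namespace CellMap

variable {V₁ E₁ V₂ E₂ V₃ E₃ : Type*}
  {Γ₁ : SerreGraph V₁ E₁} {Γ₂ : SerreGraph V₂ E₂} {Γ₃ : SerreGraph V₃ E₃}

/-- The image of an edge-path: the concatenation of the images of its edges (no tightening). -/
def mapPath (f : CellMap Γ₁ Γ₂) (p : List E₁) : List E₂ := p.flatMap f.edge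

theorem isPath_mapPath (f : CellMap Γ₁ Γ₂) {p : List E₁} {u v : V₁} (hp : Γ₁.IsPath u p v) :
    Γ₂.IsPath (f.vert u) (f.mapPath p) (f.vert v) := by
  induction p generalizing u with
  | nil => cases hp; rfl
  | cons e p ih =>
    obtain ⟨rfl, h⟩ := hp
    exact SerreGraph.IsPath.append Γ₂ (f.isPath e) (ih h)

theorem mapPath_invPath (f : CellMap Γ₁ Γ₂) (p : List E₁) :
    f.mapPath (Γ₁.invPath p) = Γ₂.invPath (f.mapPath p) := by
  induction p with
  | nil => rfl
  | cons e p ih =>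
    rw [← List.singleton_append, Γ₁.invPath_append]
    simp only [mapPath, List.flatMap_append] at ih ⊢
    rw [Γ₂.invPath_append, ih]
    simp [SerreGraph.invPath, f.edge_inv]

/-- The identity map. -/
def id (Γ : SerreGraph V₁ E₁) : CellMap Γ Γ where
  vert := fun v => v
  edge := fun e => [e]
  isPath := fun _ => ⟨rfl, rfl⟩
  edge_inv := fun _ => rfl

/-- The composition `g ∘ f`. -/
def comp (g : CellMap Γ₂ Γ₃) (f : CellMap Γ₁ Γ₂) : CellMap Γ₁ Γ₃ where
  vert := fun v => g.vert (f.vert v)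
  edge := fun e => g.mapPath (f.edge e)
  isPath := fun e => g.isPath_mapPath (f.isPath e)
  edge_inv := fun e => by rw [f.edge_inv, mapPath_invPath]

/-- Two cellular maps are (freely) homotopic. The path `h v` is the track of the vertex `v` during
the homotopy; for each edge `e` the square with sides `h (o e)`, `g e`, `f e`, `h (t e)` has to
commute up to homotopy of paths relative to endpoints. -/
def Homotopic (f g : CellMap Γ₁ Γ₂) : Prop :=
  ∃ h : V₁ → List E₂,
    (∀ v, Γ₂.IsPath (f.vert v) (h v) (g.vert v)) ∧
    ∀ e, Γ₂.PathHomotopic (f.vert (Γ₁.o e)) (g.vert (Γ₁.t e))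
      (h (Γ₁.o e) ++ g.edge e) (f.edge e ++ h (Γ₁.t e))

/-- `g` is a homotopy inverse of `f`. -/
def IsHomotopyInverse (g : CellMap Γ₂ Γ₁) (f : CellMap Γ₁ Γ₂) : Prop :=
  Homotopic (g.comp f) (id Γ₁) ∧ Homotopic (f.comp g) (id Γ₂)

/-- `f` is a homotopy equivalence. -/
def IsHomotopyEquiv (f : CellMap Γ₁ Γ₂) : Prop :=
  ∃ g : CellMap Γ₂ Γ₁, IsHomotopyInverse g f

/-- `f` is a graph-map: each edge is sent to a tight edge-path of positive length. -/
def IsGraphMap (f : CellMap Γ₁ Γ₂) : Prop :=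
  ∀ e, f.edge e ≠ [] ∧ Γ₂.IsTight (f.edge e)

/-- The map `g : R_N → R_N` induces the outer automorphism `φ` of `F_N`. -/
def InducesOut {N : ℕ} (g : CellMap (rose N) (rose N)) (φ : Out (FreeGroup (Fin N))) : Prop :=
  ∃ Φ : MulAut (FreeGroup (Fin N)),
    (QuotientGroup.mk Φ : Out (FreeGroup (Fin N))) = φ ∧
      ∀ i, Φ (FreeGroup.of i) = FreeGroup.mk (g.edge (i, true))

/-! ### Train-tracks -/

variable {V E : Type*} {Γ : SerreGraph V E}

/-- The edge-path `f^n(e)`. -/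
def iter (f : CellMap Γ Γ) (n : ℕ) (e : E) : List E := f.mapPath^[n] [e]

/-- The marking `α : R_N → Γ` and the map `f : Γ → Γ` form a topological representative of `φ`
(finiteness of `Γ` is assumed separately). -/
structure IsTopologicalRepresentative {N : ℕ} (α : CellMap (rose N) Γ) (f : CellMap Γ Γ)
    (φ : Out (FreeGroup (Fin N))) : Prop where
  connected : Γ.IsConnected
  marking : α.IsHomotopyEquiv
  graphMap : f.IsGraphMap
  homotopyEquiv : f.IsHomotopyEquiv
  induces : ∀ β : CellMap Γ (rose N), IsHomotopyInverse β α → InducesOut (β.comp (f.comp α)) φ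

/-- `f` is a train-track map (on a graph that is assumed finite and connected separately):
a graph-map all of whose iterates send edges to tight paths. -/
def IsTrainTrack (f : CellMap Γ Γ) : Prop :=
  f.IsGraphMap ∧ ∀ (e : E) (n : ℕ), 1 ≤ n → Γ.IsTight (f.iter n e)

/-- `f` is expanding: the lengths of the iterates of some edge tend to infinity. -/
def IsExpanding (f : CellMap Γ Γ) : Prop :=
  ∃ e : E, Filter.Tendsto (fun n => (f.iter n e).length) Filter.atTop Filter.atTop

/-- `(α, f)` is a train-track representative of `φ`. -/
structure IsTrainTrackRepresentative {N : ℕ} (α : CellMap (rose N) Γ) (f : CellMap Γ Γ)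
    (φ : Out (FreeGroup (Fin N))) : Prop extends IsTopologicalRepresentative α f φ where
  trainTrack : f.IsTrainTrack
  three_le_degree : ∀ v, 3 ≤ Γ.degree v

/-- The turn `e', e''` is taken by `f`. -/
def TurnTaken (f : CellMap Γ Γ) (e' e'' : E) : Prop :=
  ∃ (e : E) (n : ℕ), 1 ≤ n ∧ Γ.TurnIn e' e'' (f.iter n e)

/-- The Whitehead graph of `f` at `v`: its vertices are the oriented edges of `Γ` with origin `v`;
two distinct ones are adjacent if they form a turn taken by `f`. -/
def whiteheadGraph (f : CellMap Γ Γ) (v : V) : SimpleGraph {e : E // Γ.o e = v} where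
  Adj a b := a ≠ b ∧ f.TurnTaken a b
  symm := ⟨fun _ _ ⟨h, e, n, hn, ht⟩ => ⟨h.symm, e, n, hn, ht.symm⟩⟩
  loopless := ⟨fun _ h => h.1 rfl⟩

end CellMap

end TrainTrack

/-! Split every vertex of Γ into the components of its Whitehead graph. This gives a graph Δ with
the same edges (`splitGraph`). The map f sends taken turns to taken turns, and the turns inside each
f(e) are taken, so f lifts to a map of Δ (`splitMap`) and each f^n(e) lies in a single component of
Δ. Since Γ is recovered from Δ by gluing vertices, the groups of distinct components of Δ, together
with a complement, give a free product decomposition of F_N (`Potential.isFreeProduct`). The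
component of an expanding edge e₀ eventually runs through a cycle of components, whose groups are
the factors A_i.

Three things remain. Each factor is carried into a conjugate of the next
(`Potential.exists_conj_mem`), and onto it because cyclically permuted retracts have equally many
homomorphisms to every finite symmetric group (`map_eq_of_map_le_conj`). No factor is trivial:
otherwise a component with trivial group would contain a tight path f^q(e₀) with more edges than Δ
has vertices, hence a tight closed path (`length_le_of_trivial`). No factor is all of F_N: otherwise
what lies outside its component is a forest attached to it, and counting edges contradicts degree at
least 3 together with the existence of a vertex that is really split (`card_le_of_group_eq_top`,
`two_mul_card_lt`).

Fundamental groups enter only through voltages. The marking gives a voltage ν with values in F_N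
through which all others factor up to coboundary, and a spanning tree is replaced by a potential
making ν trivial along it. -/

/-! ### Residual finiteness of free groups -/

theorem exists_perm_extending {X : Type*} [Finite X] (R : X → X → Prop)
    (hfun : ∀ x y y', R x y → R x y' → y = y') (hinj : ∀ x x' y, R x y → R x' y → x = x') :
    ∃ σ : Equiv.Perm X, ∀ x y, R x y → σ x = y := by
  classical
  let F : {x // ∃ y, R x y} → {y // ∃ x, R x y} := fun x => ⟨x.2.choose, x.1, x.2.choose_spec⟩
  have hF : Function.Bijective F := by
    constructor
    · intro a b hab
      have h : a.2.choose = b.2.choose := congrArg Subtype.val hab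
      have hb := b.2.choose_spec
      rw [← h] at hb
      exact Subtype.ext (hinj _ _ _ a.2.choose_spec hb)
    · rintro ⟨y, x, h⟩
      exact ⟨⟨x, y, h⟩, Subtype.ext (hfun x _ _ (Exists.choose_spec (p := fun y => R x y) ⟨y, h⟩) h)⟩
  refine ⟨(Equiv.ofBijective F hF).extendSubtype, fun x y h => ?_⟩
  rw [Equiv.extendSubtype_apply_of_mem _ x ⟨y, h⟩]
  exact hfun x _ _ (Exists.choose_spec (p := fun y => R x y) ⟨y, h⟩) h

/-- Let the reduced word of g act along a line of points, one step per letter. Reducedness makes the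
prescribed moves of each generator a partial injection, which extends to a permutation, and g then
moves one end of the line to the other. -/
theorem FreeGroup.exists_hom_perm_ne_one {α : Type*} {g : FreeGroup α} (hg : g ≠ 1) :
    ∃ (n : ℕ) (θ : FreeGroup α →* Equiv.Perm (Fin n)), θ g ≠ 1 := by
  classical
  obtain ⟨L, hL⟩ : ∃ L, L = g.toWord := ⟨_, rfl⟩
  have hred : FreeGroup.IsReduced L := hL ▸ FreeGroup.isReduced_toWord
  have hne : L ≠ [] := by rw [hL]; simpa using hg
  have hadj : ∀ (j : ℕ) (h : j + 1 < L.length), L[j].1 = L[j + 1].1 → L[j].2 = L[j + 1].2 := by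
    intro j h
    exact (List.isChain_iff_getElem.mp hred) j h
  -- Permutations compose from the right, so the word is read from its last letter: letter j has to
  -- move the point j + 1 to j.
  let R : α → Fin (L.length + 1) → Fin (L.length + 1) → Prop := fun a x y =>
    ∃ (j : ℕ) (h : j < L.length),
      (L[j] = (a, true) ∧ x.1 = j + 1 ∧ y.1 = j) ∨ (L[j] = (a, false) ∧ x.1 = j ∧ y.1 = j + 1)
  have hσ : ∀ a, ∃ σ : Equiv.Perm (Fin (L.length + 1)), ∀ x y, R a x y → σ x = y := by
    intro a
    apply exists_perm_extending
    · rintro x y y' ⟨j, hj, h⟩ ⟨i, hi, h'⟩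
      apply Fin.ext
      rcases h with ⟨h1, h2, h3⟩ | ⟨h1, h2, h3⟩ <;> rcases h' with ⟨h1', h2', h3'⟩ | ⟨h1', h2', h3'⟩
      · omega
      · obtain rfl : i = j + 1 := by omega
        have := hadj j hi
        simp [h1, h1'] at this
      · obtain rfl : j = i + 1 := by omega
        have := hadj i hj
        simp [h1, h1'] at this
      · omega
    · rintro x y y' ⟨j, hj, h⟩ ⟨i, hi, h'⟩
      apply Fin.ext
      rcases h with ⟨h1, h2, h3⟩ | ⟨h1, h2, h3⟩ <;> rcases h' with ⟨h1', h2', h3'⟩ | ⟨h1', h2', h3'⟩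
      · omega
      · obtain rfl : j = i + 1 := by omega
        have := hadj i hj
        simp [h1, h1'] at this
      · obtain rfl : i = j + 1 := by omega
        have := hadj j hi
        simp [h1, h1'] at this
      · omega
  choose σ hσ using hσ
  have key : ∀ k, k ≤ L.length → ∀ hk : L.length - k < L.length + 1,
      FreeGroup.lift σ (FreeGroup.mk (L.drop (L.length - k))) (Fin.last _) =
        ⟨L.length - k, hk⟩ := by
    intro k
    induction k with
    | zero => intro _ _; simp [← FreeGroup.one_eq_mk, Fin.last]
    | succ k ih =>
      intro hk hk'
      have hlt : L.length - (k + 1) < L.length := by omega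
      have hs : L.length - (k + 1) + 1 = L.length - k := by omega
      rw [List.drop_eq_getElem_cons hlt, hs, ← List.singleton_append, ← FreeGroup.mul_mk, _root_.map_mul,
        Equiv.Perm.mul_apply, ih (by omega) (by omega)]
      rcases hx : L[L.length - (k + 1)] with ⟨a, b⟩
      cases b
      · simp only [FreeGroup.lift_mk, List.map_cons, List.map_nil, List.prod_cons, List.prod_nil,
          mul_one, cond_false]
        rw [Equiv.Perm.inv_eq_iff_eq]
        exact (hσ a _ _ ⟨_, hlt, Or.inr ⟨hx, rfl, hs.symm⟩⟩).symm
      · simp only [FreeGroup.lift_mk, List.map_cons, List.map_nil, List.prod_cons, List.prod_nil,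
          mul_one, cond_true]
        exact hσ a _ _ ⟨_, hlt, Or.inl ⟨hx, hs.symm, rfl⟩⟩
  refine ⟨_, FreeGroup.lift σ, fun h => ?_⟩
  have := key L.length le_rfl (by omega)
  simp only [Nat.sub_self, List.drop_zero] at this
  have hg' : FreeGroup.mk L = g := by rw [hL, FreeGroup.mk_toWord]
  rw [hg', h] at this
  have h0 := congrArg Fin.val this
  simp at h0
  exact hne h0

/-! ### Cyclically permuted retracts -/

/-- If an automorphism of `G` carries each member of a finite family of retracts into a conjugate of
a member, permuting the family, then it carries it onto that conjugate, provided that `G` has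
finitely many homomorphisms to each finite symmetric group and these separate points. -/
theorem map_eq_of_map_le_conj {G : Type*} [Group G]
    (hfin : ∀ n, Finite (G →* Equiv.Perm (Fin n)))
    (hres : ∀ g : G, g ≠ 1 → ∃ (n : ℕ) (θ : G →* Equiv.Perm (Fin n)), θ g ≠ 1)
    {k : ℕ} (A : Fin k → Subgroup G) (r : ∀ i, G →* A i) (hr : ∀ i (a : A i), r i a = a)
    (Φ : MulAut G) (σ : Equiv.Perm (Fin k)) (g : Fin k → G)
    (hΦ : ∀ i, ∀ a ∈ A i, (g i)⁻¹ * Φ a * g i ∈ A (σ i)) (i : Fin k) :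
    (A i).map Φ.toMonoidHom = (A (σ i)).map (MulAut.conj (g i)).toMonoidHom := by
  let T : ∀ i, MulAut G := fun i => MulAut.conj (g i)⁻¹ * Φ
  have hT : ∀ i a, T i a = (g i)⁻¹ * Φ a * g i := by intro i a; simp [T]
  let Ψ : ∀ i, A i →* A (σ i) := fun i =>
    ((T i).toMonoidHom.comp (A i).subtype).codRestrict (A (σ i)) (fun a => by
      simpa [T] using hΦ i a a.2)
  have hΨ : ∀ i (a : A i), (Ψ i a : G) = T i a := fun i a => rfl
  -- The retraction turns the inverse automorphism into a left inverse of `Ψ i`, so restriction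
  -- along `Ψ i` is surjective on homomorphisms to symmetric groups.
  let ρ : ∀ i, A (σ i) →* A i := fun i =>
    (r i).comp ((T i).symm.toMonoidHom.comp (A (σ i)).subtype)
  have hρ : ∀ i (a : A i), ρ i (Ψ i a) = a := by
    intro i a
    change r i ((T i).symm (T i a)) = a
    rw [MulEquiv.symm_apply_apply, hr]
  have hfinA : ∀ n i, Finite (A i →* Equiv.Perm (Fin n)) := by
    intro n i
    have := hfin n
    refine Finite.of_injective (fun h : A i →* Equiv.Perm (Fin n) => h.comp (r i)) ?_
    intro h h' hh
    ext1 a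
    simpa [hr] using DFunLike.congr_fun hh (a : G)
  have hsurj : ∀ n i, Function.Surjective
      (fun h : A (σ i) →* Equiv.Perm (Fin n) => h.comp (Ψ i)) := by
    intro n i h
    refine ⟨h.comp (ρ i), ?_⟩
    ext1 a
    simp [hρ]
  have hcard : ∀ n i, Nat.card (A (σ i) →* Equiv.Perm (Fin n)) =
      Nat.card (A i →* Equiv.Perm (Fin n)) := by
    intro n i
    have hle : ∀ i ∈ Finset.univ, Nat.card (A i →* Equiv.Perm (Fin n)) ≤
        Nat.card (A (σ i) →* Equiv.Perm (Fin n)) := by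
      intro i _
      have := hfinA n (σ i)
      exact Nat.card_le_card_of_surjective _ (hsurj n i)
    -- The cardinalities weakly increase along σ while their sum is unchanged, so all the
    -- inequalities are equalities.
    have hsum := Equiv.sum_comp σ (fun i => Nat.card (A i →* Equiv.Perm (Fin n)))
    exact ((Finset.sum_eq_sum_iff_of_le hle).mp hsum.symm i (Finset.mem_univ _)).symm
  have hinj : ∀ n i, Function.Injective
      (fun h : A (σ i) →* Equiv.Perm (Fin n) => h.comp (Ψ i)) := by
    intro n i
    have := hfinA n i
    have := hfinA n (σ i)
    exact ((hsurj n i).bijective_of_nat_card_le (hcard n i).le).1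
  have hright : ∀ b : A (σ i), Ψ i (ρ i b) = b := by
    intro b
    by_contra hne
    have : ((Ψ i (ρ i b) : G) * (b : G)⁻¹) ≠ 1 := by
      rw [Ne, mul_inv_eq_one]
      exact fun h => hne (Subtype.ext h)
    obtain ⟨n, θ, hθ⟩ := hres _ this
    apply hθ
    -- Both sides agree after composition with `Ψ i`, which is injective on homomorphisms to a
    -- finite symmetric group. Thus none of these separates b from `Ψ i (ρ i b)`.
    have h2 : (θ.comp (A (σ i)).subtype).comp ((Ψ i).comp (ρ i)) = θ.comp (A (σ i)).subtype := by
      apply hinj n i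
      ext1 a
      simp [hρ]
    have h3 := DFunLike.congr_fun h2 b
    rw [map_mul, map_inv, mul_inv_eq_one]
    exact h3
  apply le_antisymm
  · rintro _ ⟨a, ha, rfl⟩
    exact ⟨_, hΦ i a ha, by simp [MulAut.conj_apply, mul_assoc]⟩
  · rintro _ ⟨b, hb, rfl⟩
    refine ⟨_, (ρ i ⟨b, hb⟩).2, ?_⟩
    have h1 := congrArg Subtype.val (hright ⟨b, hb⟩)
    rw [hΨ, hT] at h1
    change Φ _ = g i * b * (g i)⁻¹
    refine Eq.trans ?_ (congrArg (fun z => g i * z * (g i)⁻¹) h1)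
    group

namespace TrainTrack

/-! ### Voltages -/

/-- The value of a voltage assignment on an edge-path. -/
def volt {E H : Type*} [Group H] (l : E → H) (p : List E) : H := (p.map l).prod

section volt

variable {E H : Type*} [Group H] (l : E → H)

@[simp] theorem volt_nil : volt l [] = 1 := rfl

@[simp] theorem volt_cons (e : E) (p : List E) : volt l (e :: p) = l e * volt l p := by
  simp [volt]

@[simp] theorem volt_append (p q : List E) : volt l (p ++ q) = volt l p * volt l q := by
  simp [volt]

end volt

namespace SerreGraph

variable {V E H : Type*} [Group H] (Γ : SerreGraph V E)

/-- A voltage assignment on `Γ` with values in the group `H`. -/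
def IsVoltage (l : E → H) : Prop := ∀ e, l (Γ.inv e) = (l e)⁻¹

variable {Γ}

theorem IsVoltage.volt_invPath {l : E → H} (hl : Γ.IsVoltage l) (p : List E) :
    volt l (Γ.invPath p) = (volt l p)⁻¹ := by
  induction p with
  | nil => simp [invPath]
  | cons e p ih =>
    rw [← List.singleton_append, Γ.invPath_append, volt_append, ih]
    simp [invPath, hl e]

theorem IsVoltage.volt_eq_of_homotopic {l : E → H} (hl : Γ.IsVoltage l) {u v : V} {p q : List E}
    (h : Γ.PathHomotopic u v p q) : volt l p = volt l q := by
  obtain ⟨-, -, h⟩ := h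
  induction h with
  | rel p q h =>
    obtain ⟨-, -, a, b, e, rfl, rfl⟩ := h
    simp [hl e]
  | refl => rfl
  | symm _ _ _ ih => exact ih.symm
  | trans _ _ _ _ _ ih ih' => exact ih.trans ih'

end SerreGraph

namespace CellMap

variable {V₁ E₁ V₂ E₂ H : Type*} [Group H] {Γ₁ : SerreGraph V₁ E₁} {Γ₂ : SerreGraph V₂ E₂}

theorem volt_mapPath (f : CellMap Γ₁ Γ₂) (l : E₂ → H) (p : List E₁) :
    volt l (f.mapPath p) = volt (fun e => volt l (f.edge e)) p := by
  induction p with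
  | nil => rfl
  | cons e p ih =>
    rw [volt_cons, ← ih]
    simp [mapPath]

theorem isVoltage_comp (f : CellMap Γ₁ Γ₂) {l : E₂ → H} (hl : Γ₂.IsVoltage l) :
    Γ₁.IsVoltage (fun e => volt l (f.edge e)) := by
  intro e
  simp only [f.edge_inv]
  exact hl.volt_invPath _

end CellMap

theorem rose_volt_eq_lift {N : ℕ} {H : Type*} [Group H] {l : Fin N × Bool → H}
    (hl : (rose N).IsVoltage l) (w : List (Fin N × Bool)) :
    volt l w = FreeGroup.lift (fun i => l (i, true)) (FreeGroup.mk w) := by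
  rw [FreeGroup.lift_mk, volt]
  congr 1
  apply List.map_congr_left
  rintro ⟨i, b⟩ -
  cases b
  · exact hl (i, true)
  · rfl

theorem rose_isVoltage_mk {N : ℕ} :
    (rose N).IsVoltage (fun x => (FreeGroup.mk [x] : FreeGroup (Fin N))) := by
  intro x
  simp [rose, FreeGroup.invRev]

theorem volt_mk_singleton {N : ℕ} (w : List (Fin N × Bool)) :
    volt (fun x => (FreeGroup.mk [x] : FreeGroup (Fin N))) w = FreeGroup.mk w := by
  induction w with
  | nil => rfl
  | cons x w ih => rw [volt_cons, ih, FreeGroup.mul_mk]; rfl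

section marking

variable {V E : Type*} {Γ : SerreGraph V E} {N : ℕ} {α : CellMap (rose N) Γ}
  {β : CellMap Γ (rose N)}

/-- The voltage on `Γ` with values in the free group that is given by a map to the rose. -/
def markVolt (β : CellMap Γ (rose N)) (e : E) : FreeGroup (Fin N) := FreeGroup.mk (β.edge e)

theorem isVoltage_markVolt (β : CellMap Γ (rose N)) : Γ.IsVoltage (markVolt β) := by
  have := β.isVoltage_comp (rose_isVoltage_mk (N := N))
  simp only [volt_mk_singleton] at this
  exact this

theorem volt_markVolt (β : CellMap Γ (rose N)) (p : List E) :
    volt (markVolt β) p = FreeGroup.mk (β.mapPath p) := by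
  rw [← volt_mk_singleton, β.volt_mapPath]
  simp only [volt_mk_singleton]
  rfl

/-- Every voltage on `Γ` is, up to a coboundary, induced from the marking voltage. -/
theorem exists_eq_lift_markVolt (h : (α.comp β).Homotopic (CellMap.id Γ)) {H : Type*} [Group H]
    {l : E → H} (hl : Γ.IsVoltage l) :
    ∃ k : V → H, ∀ e, l e = (k (Γ.o e))⁻¹ *
      FreeGroup.lift (fun i => volt l (α.edge (i, true))) (markVolt β e) * k (Γ.t e) := by
  obtain ⟨t, -, ht⟩ := h
  -- The coboundary is the voltage along the tracks of the vertices under the homotopy from α ∘ β to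
  -- the identity.
  refine ⟨fun v => volt l (t v), fun e => ?_⟩
  have h1 := hl.volt_eq_of_homotopic (ht e)
  have h2 : volt l ((α.comp β).edge e) =
      FreeGroup.lift (fun i => volt l (α.edge (i, true))) (markVolt β e) := by
    change volt l (α.mapPath (β.edge e)) = _
    rw [α.volt_mapPath, rose_volt_eq_lift (α.isVoltage_comp hl)]
    rfl
  rw [volt_append, volt_append, h2] at h1
  change volt l (t (Γ.o e)) * volt l [e] = _ at h1
  rw [volt_cons, volt_nil, mul_one] at h1
  rw [mul_assoc, ← h1, inv_mul_cancel_left]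

/-- Surjectivity of the marking on loops: the α-image of a word w has voltage w conjugated by the
track of the base point, so conjugating g back first yields the required loop. -/
theorem exists_loop_volt_eq (h : (β.comp α).Homotopic (CellMap.id (rose N)))
    (g : FreeGroup (Fin N)) :
    ∃ p, Γ.IsPath (α.vert ()) p (α.vert ()) ∧ volt (markVolt β) p = g := by
  obtain ⟨t, -, ht⟩ := h
  have hrose : ∀ w : List (Fin N × Bool), (rose N).IsPath () w () := by
    intro w
    induction w with
    | nil => rfl
    | cons x w ih => exact ⟨rfl, ih⟩
  have key : ∀ w : List (Fin N × Bool),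
      volt (markVolt β) (α.mapPath w) =
        FreeGroup.mk (t ()) * FreeGroup.mk w * (FreeGroup.mk (t ()))⁻¹ := by
    intro w
    induction w with
    | nil =>
      simp only [CellMap.mapPath, List.flatMap_nil, volt_nil, ← FreeGroup.one_eq_mk, mul_one,
        mul_inv_cancel]
    | cons x w ih =>
      have h1 := rose_isVoltage_mk.volt_eq_of_homotopic (ht x)
      change volt _ (t () ++ [x]) = volt _ (β.mapPath (α.edge x) ++ t ()) at h1
      rw [volt_append, volt_append, volt_mk_singleton, volt_mk_singleton, volt_mk_singleton,
        ← volt_markVolt] at h1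
      have h2 : α.mapPath (x :: w) = α.edge x ++ α.mapPath w := by simp [CellMap.mapPath]
      rw [h2, volt_append, ih, ← List.singleton_append (l := w), ← FreeGroup.mul_mk,
        eq_mul_inv_of_mul_eq h1.symm]
      group
  refine ⟨α.mapPath ((FreeGroup.mk (t ()))⁻¹ * g * FreeGroup.mk (t ())).toWord,
    α.isPath_mapPath (hrose _), ?_⟩
  rw [key, FreeGroup.mk_toWord]
  group

end marking

/-! ### Spanning forests as potentials -/

/-- The edges on which the voltage `ν` is the coboundary of `d`. -/
def TrivialEdge {V E G : Type*} [Group G] (o t : E → V) (ν : E → G) (d : V → G) (u v : V) : Prop :=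
  ∃ e, o e = u ∧ t e = v ∧ d u * ν e * (d v)⁻¹ = 1

/-- There is a potential whose trivial edges connect any two vertices connected by an edge. -/
theorem exists_spanning_potential {V E G : Type*} [Group G] [Finite E] (o t : E → V) (ν : E → G) :
    ∃ d : V → G, ∀ e, Quot.mk (TrivialEdge o t ν d) (o e) = Quot.mk _ (t e) := by
  classical
  have := Fintype.ofFinite E
  suffices h : ∀ S : Finset E, ∃ d : V → G, ∀ e ∈ S,
      Quot.mk (TrivialEdge o t ν d) (o e) = Quot.mk _ (t e) by
    obtain ⟨d, hd⟩ := h Finset.univ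
    exact ⟨d, fun e => hd e (Finset.mem_univ e)⟩
  intro S
  induction S using Finset.induction_on with
  | empty => exact ⟨1, by simp⟩
  | insert a S _ ih =>
    obtain ⟨d, hd⟩ := ih
    by_cases ha : Quot.mk (TrivialEdge o t ν d) (o a) = Quot.mk _ (t a)
    · refine ⟨d, fun e he => ?_⟩
      rcases Finset.mem_insert.mp he with rfl | he
      exacts [ha, hd e he]
    · let g := d (o a) * ν a * (d (t a))⁻¹
      -- Multiplying d by g on the class of the endpoint of a makes a trivial. Edges that were
      -- already trivial stay so, since s is constant on classes.
      let s : V → G := fun v => if Quot.mk (TrivialEdge o t ν d) v = Quot.mk _ (t a) then g else 1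
      have hs : ∀ u v, TrivialEdge o t ν d u v → s u = s v := by
        intro u v h
        simp only [s, Quot.sound h]
      have hsub : ∀ u v, TrivialEdge o t ν d u v → TrivialEdge o t ν (fun v => s v * d v) u v := by
        rintro u v h
        have h' := hs u v h
        obtain ⟨e, he, he', h1⟩ := h
        refine ⟨e, he, he', ?_⟩
        beta_reduce
        rw [h', mul_inv_rev]
        calc s v * d u * ν e * ((d v)⁻¹ * (s v)⁻¹) = s v * (d u * ν e * (d v)⁻¹) * (s v)⁻¹ := by
              group
          _ = 1 := by rw [h1]; group
      refine ⟨fun v => s v * d v, fun e he => ?_⟩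
      rcases Finset.mem_insert.mp he with rfl | he
      · apply Quot.sound
        refine ⟨e, rfl, rfl, ?_⟩
        have h1 : s (o e) = 1 := if_neg ha
        have h2 : s (t e) = g := if_pos rfl
        beta_reduce
        rw [h1, h2]
        simp only [g]
        group
      · exact congrArg (Quot.map (fun v => v) hsub) (hd e he)

/-! ### Splitting vertices of a graph -/

/-- The graph `Γ` arises from `Δ`, which has the same edges, by identifying vertices. -/
structure Splitting {C V E : Type*} (Δ : SerreGraph C E) (Γ : SerreGraph V E) where
  proj : C → V
  inv_eq : ∀ e, Δ.inv e = Γ.inv e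
  proj_o : ∀ e, proj (Δ.o e) = Γ.o e

namespace Splitting

variable {C V E : Type*} {Δ : SerreGraph C E} {Γ : SerreGraph V E} (s : Splitting Δ Γ)
  {G : Type*} [Group G]

theorem proj_t (e : E) : s.proj (Δ.t e) = Γ.t e := by
  rw [SerreGraph.t, s.proj_o, s.inv_eq]
  rfl

/-- The voltage `ν`, made trivial on a new edge from `s.proj c` to `c` for every vertex `c` of `Δ`,
after the change by a potential. -/
def gen (ν : E → G) (dV : V → G) (dC : C → G) : E ⊕ C → G
  | .inl e => dC (Δ.o e) * ν e * (dC (Δ.t e))⁻¹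
  | .inr c => dV (s.proj c) * (dC c)⁻¹

/-- A potential that is trivial along a spanning forest of `Δ` and along a spanning tree, which
contains this forest, of the graph `Δ` with new edges from `s.proj c` to `c`. -/
structure Potential (ν : E → G) where
  dV : V → G
  dC : C → G
  forest : ∀ e, Quot.mk (TrivialEdge Δ.o Δ.t ν dC) (Δ.o e) = Quot.mk _ (Δ.t e)
  tree : ∀ {X : Type} (mV : V → X) (mC : C → X),
    (∀ e, s.gen ν dV dC (.inl e) = 1 → mC (Δ.o e) = mC (Δ.t e)) →
    (∀ c, s.gen ν dV dC (.inr c) = 1 → mV (s.proj c) = mC c) →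
    ∀ v c, mV v = mC c

/-- The tree is built in two stages: d trivialises a spanning forest of Δ, then b trivialises a
spanning forest of the new edges once each component of Δ is collapsed to a point. Correcting d by b
is constant on components and so only conjugates the voltages of the first forest. -/
theorem nonempty_potential [Finite E] [Finite C]
    (hΓ : Γ.IsConnected) (ν : E → G) : Nonempty (s.Potential ν) := by
  obtain ⟨d, hd⟩ := exists_spanning_potential Δ.o Δ.t ν
  let K : C → Quot (fun c c' => ∃ e, Δ.o e = c ∧ Δ.t e = c') := Quot.mk _
  obtain ⟨b, hb⟩ := exists_spanning_potential (E := C) (V := V ⊕ Quot _)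
    (fun c => Sum.inl (s.proj c)) (fun c => Sum.inr (K c)) (fun c => (d c)⁻¹)
  have hforest : ∀ {X : Type} (mC : C → X),
      (∀ e, s.gen ν (fun v => b (.inl v)) (fun c => b (.inr (K c)) * d c) (.inl e) = 1 →
        mC (Δ.o e) = mC (Δ.t e)) → ∀ e, mC (Δ.o e) = mC (Δ.t e) := by
    intro X mC h e
    refine congrArg (Quot.lift mC ?_) (hd e)
    rintro _ _ ⟨e, rfl, rfl, h1⟩
    apply h
    have hK : K (Δ.o e) = K (Δ.t e) := Quot.sound ⟨e, rfl, rfl⟩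
    simp only [gen]
    rw [hK]
    calc _ = b (.inr (K (Δ.t e))) * (d (Δ.o e) * ν e * (d (Δ.t e))⁻¹) *
          (b (.inr (K (Δ.t e))))⁻¹ := by group
      _ = 1 := by rw [h1]; group
  refine ⟨⟨fun v => b (.inl v), fun c => b (.inr (K c)) * d c, fun e => ?_, ?_⟩⟩
  · refine congrArg (Quot.map (fun c => c) ?_) (hd e)
    rintro _ _ ⟨e, rfl, rfl, h1⟩
    refine ⟨e, rfl, rfl, ?_⟩
    have hK : K (Δ.o e) = K (Δ.t e) := Quot.sound ⟨e, rfl, rfl⟩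
    beta_reduce
    rw [hK]
    calc _ = b (.inr (K (Δ.t e))) * (d (Δ.o e) * ν e * (d (Δ.t e))⁻¹) *
          (b (.inr (K (Δ.t e))))⁻¹ := by group
      _ = 1 := by rw [h1]; group
  · intro X mV mC h1 h2
    have hm := hforest mC h1
    let m : V ⊕ Quot (fun c c' => ∃ e, Δ.o e = c ∧ Δ.t e = c') → X :=
      Sum.elim mV (Quot.lift mC (by rintro _ _ ⟨e, rfl, rfl⟩; exact hm e))
    have hproj : ∀ c, mV (s.proj c) = mC c := by
      intro c
      refine congrArg (Quot.lift m ?_) (hb c)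
      rintro _ _ ⟨c, rfl, rfl, h3⟩
      refine h2 c ?_
      simp only [gen]
      rw [mul_inv_rev, ← mul_assoc]
      exact h3
    have hedge : ∀ e, mV (Γ.o e) = mV (Γ.t e) := by
      intro e
      rw [← s.proj_o, ← s.proj_t, hproj, hproj, hm]
    have hpath : ∀ p u v, Γ.IsPath u p v → mV u = mV v := by
      intro p
      induction p with
      | nil => intro u v h; rw [show u = v from h]
      | cons e p ih => intro u v h; rw [← h.1, hedge, ih _ _ h.2]
    intro v c
    obtain ⟨p, hp⟩ := hΓ.2 v (s.proj c)
    rw [hpath p _ _ hp, hproj]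

end Splitting

/-! ### Universal voltages -/

namespace SerreGraph

/-- Every voltage on `Γ` is, up to a coboundary, the image of `ν` under a homomorphism. -/
def IsUniversalVoltage.{w, u₁, u₂, u₃} {V : Type u₁} {E : Type u₂} (Γ : SerreGraph V E)
    {G : Type u₃} [Group G] (ν : E → G) : Prop :=
  ∀ (H : Type w) [Group H] (l : E → H), Γ.IsVoltage l →
    ∃ (θ : G →* H) (k : V → H), ∀ e, l e = (k (Γ.o e))⁻¹ * θ (ν e) * k (Γ.t e)

variable {V E : Type*} {Γ : SerreGraph V E}

theorem isPath_append_iff {p q : List E} {u w : V} :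
    Γ.IsPath u (p ++ q) w ↔ ∃ v, Γ.IsPath u p v ∧ Γ.IsPath v q w := by
  refine ⟨fun h => ?_, fun ⟨v, hp, hq⟩ => hp.append Γ hq⟩
  induction p generalizing u with
  | nil => exact ⟨u, rfl, h⟩
  | cons e p ih =>
    obtain ⟨v, h1, h2⟩ := ih h.2
    exact ⟨v, ⟨h.1, h1⟩, h2⟩

theorem volt_eq_of_coboundary {H : Type*} [Group H] {l m : E → H} {k : V → H} {p : List E} {u v : V}
    (hp : Γ.IsPath u p v) (h : ∀ e ∈ p, l e = (k (Γ.o e))⁻¹ * m e * k (Γ.t e)) :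
    volt l p = (k u)⁻¹ * volt m p * k v := by
  induction p generalizing u with
  | nil => rw [show u = v from hp]; simp
  | cons e p ih =>
    obtain ⟨rfl, hp⟩ := hp
    rw [volt_cons, volt_cons, h e (by simp), ih hp fun e' he' => h e' (by simp [he'])]
    group

theorem volt_map_hom {G H : Type*} [Group G] [Group H] (θ : G →* H) (ν : E → G) (p : List E) :
    volt (fun e => θ (ν e)) p = θ (volt ν p) := by
  induction p with
  | nil => simp
  | cons e p ih => simp [ih]

variable (Γ) in
/-- A voltage that is non-trivial on each non-empty tight path. -/
def tightVolt (e : E) : FreeGroup E := FreeGroup.of e * (FreeGroup.of (Γ.inv e))⁻¹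

theorem isVoltage_tightVolt : Γ.IsVoltage Γ.tightVolt := by
  intro e
  simp [tightVolt, Γ.inv_inv]

/-- The word that spells this product is already reduced: inside the contribution of an edge because
`Γ.inv e ≠ e`, and between consecutive edges by tightness. -/
theorem volt_tightVolt_ne_one {p : List E} (hp : Γ.IsTight p) (hne : p ≠ []) :
    volt Γ.tightVolt p ≠ 1 := by
  classical
  let w : List E → List (E × Bool) := fun p => p.flatMap fun e => [(e, true), (Γ.inv e, false)]
  have h1 : ∀ p, volt Γ.tightVolt p = FreeGroup.mk (w p) := by
    intro p
    induction p with
    | nil => rfl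
    | cons e p ih =>
      have h : w (e :: p) = [(e, true)] ++ ([(Γ.inv e, false)] ++ w p) := by simp [w]
      rw [volt_cons, ih, h, ← FreeGroup.mul_mk, ← FreeGroup.mul_mk, ← mul_assoc]
      rfl
  have h2 : ∀ p, Γ.IsTight p → FreeGroup.IsReduced (w p) := by
    intro p hp
    induction p with
    | nil => exact FreeGroup.IsReduced.nil
    | cons e p ih =>
      have h : w (e :: p) = (e, true) :: (Γ.inv e, false) :: w p := by simp [w]
      rw [h, FreeGroup.isReduced_cons_cons]
      refine ⟨fun h => absurd h.symm (Γ.inv_ne e), ?_⟩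
      cases p with
      | nil => exact FreeGroup.IsReduced.singleton
      | cons e' p =>
        have hw : w (e' :: p) = (e', true) :: (Γ.inv e', false) :: w p := by simp [w]
        have h3 := List.isChain_cons_cons.mp hp
        have h4 := ih h3.2
        rw [hw] at h4 ⊢
        rw [FreeGroup.isReduced_cons_cons]
        exact ⟨fun h => absurd h.symm h3.1, h4⟩
  intro h
  rw [h1, FreeGroup.one_eq_mk] at h
  have h3 := congrArg FreeGroup.toWord h
  rw [FreeGroup.toWord_mk, FreeGroup.toWord_mk, (h2 p hp).reduce_eq] at h3
  cases p with
  | nil => exact hne rfl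
  | cons e p => simp [w] at h3

theorem IsUniversalVoltage.volt_ne_one.{u₁, u₂} {V : Type u₁} {E : Type u₂} {Γ : SerreGraph V E}
    {G : Type*} [Group G] {ν : E → G} (hν : IsUniversalVoltage.{u₂} Γ ν)
    {p : List E} {v : V} (hp : Γ.IsPath v p v) (ht : Γ.IsTight p) (hne : p ≠ []) :
    volt ν p ≠ 1 := by
  intro h
  obtain ⟨θ, k, hk⟩ := hν (FreeGroup E) Γ.tightVolt isVoltage_tightVolt
  apply volt_tightVolt_ne_one ht hne
  rw [volt_eq_of_coboundary hp fun e _ => hk e, volt_map_hom, h, map_one]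
  group

/-- A voltage trivialised by a potential on a long tight path is not universal. -/
theorem IsUniversalVoltage.length_le_of_trivial.{u₁, u₂} {V : Type u₁} {E : Type u₂}
    {Γ : SerreGraph V E} {C : Type*} [Finite C] {Δ : SerreGraph C E} (s : Splitting Δ Γ)
    {G : Type*} [Group G] {ν : E → G}
    (hν : IsUniversalVoltage.{u₂} Γ ν) (d : C → G) {p : List E} {c c' : C} (hp : Δ.IsPath c p c')
    (ht : Γ.IsTight p) (h : ∀ e ∈ p, d (Δ.o e) * ν e * (d (Δ.t e))⁻¹ = 1) :
    p.length ≤ Nat.card C := by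
  classical
  have := Fintype.ofFinite C
  by_contra hlt
  rw [Nat.card_eq_fintype_card] at hlt
  -- Pigeonhole on the origins in Δ cuts out a non-empty closed subpath. Being tight in Γ it has
  -- non-trivial voltage, but the potential makes its voltage trivial.
  obtain ⟨i, j, hij, hoij⟩ : ∃ i j : Fin p.length, i < j ∧ Δ.o p[i] = Δ.o p[j] := by
    obtain ⟨i, j, hij, h⟩ := Fintype.exists_ne_map_eq_of_card_lt
      (fun i : Fin p.length => Δ.o p[i]) (by simpa using hlt)
    rcases lt_or_gt_of_ne hij with h' | h'
    exacts [⟨i, j, h', h⟩, ⟨j, i, h', h.symm⟩]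
  have hlt' : i.1 < j.1 := hij
  have hdec : p = p.take i ++ ((p.drop i).take (j - i) ++ p.drop j) := by
    have h1 : p.drop j = (p.drop i).drop (j - i) := by
      rw [List.drop_drop]; congr 1; omega
    rw [h1, List.take_append_drop, List.take_append_drop]
  let q := (p.drop i).take (j - i)
  have hq : q ≠ [] := by
    apply List.ne_nil_of_length_pos
    simp only [q, List.length_take, List.length_drop]
    omega
  have hinf : q <:+: p := ⟨_, _, by rw [List.append_assoc]; exact hdec.symm⟩
  have hp' := hp
  rw [hdec, isPath_append_iff] at hp'
  obtain ⟨v, -, hp'⟩ := hp'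
  obtain ⟨w, hvq, hw⟩ := isPath_append_iff.mp hp'
  have hwj : Δ.o p[j] = w := by
    rw [List.drop_eq_getElem_cons j.2] at hw
    exact hw.1
  have hvi : Δ.o p[i] = v := by
    have h1 : q ++ p.drop j = p.drop i := by
      have h1 : p.drop j = (p.drop i).drop (j - i) := by
        rw [List.drop_drop]; congr 1; omega
      rw [h1, List.take_append_drop]
    change Δ.IsPath v (q ++ p.drop j) c' at hp'
    rw [h1, List.drop_eq_getElem_cons i.2] at hp'
    exact hp'.1
  obtain rfl : v = w := by rw [← hwj, ← hvi, hoij]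
  have hproj : ∀ (q : List E) (a b : C), Δ.IsPath a q b → Γ.IsPath (s.proj a) q (s.proj b) := by
    intro q
    induction q with
    | nil => intro a b h; exact congrArg s.proj h
    | cons e q ih =>
      rintro a b ⟨rfl, h⟩
      refine ⟨(s.proj_o e).symm, ?_⟩
      rw [← s.proj_t]
      exact ih _ _ h
  refine hν.volt_ne_one (hproj q v v hvq) (List.IsChain.infix ht hinf) hq ?_
  have h1 : volt ν q = (d v)⁻¹ * volt (fun _ => 1) q * d v := by
    refine volt_eq_of_coboundary hvq fun e he => ?_
    have h2 := h e (hinf.subset he)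
    rw [mul_inv_eq_one, ← eq_inv_mul_iff_mul_eq] at h2
    rw [h2, mul_one]
  rw [h1]
  simp [volt]

/-- The type of connected components. -/
def Component : Type _ := Quot fun c c' => ∃ e, Γ.o e = c ∧ Γ.t e = c'

variable (Γ) in
/-- The connected component of a vertex. -/
def component (v : V) : Γ.Component := Quot.mk _ v

theorem component_o (e : E) : Γ.component (Γ.o e) = Γ.component (Γ.t e) :=
  Quot.sound ⟨e, rfl, rfl⟩

theorem IsPath.component_eq {p : List E} {u v : V} (h : Γ.IsPath u p v) :
    Γ.component u = Γ.component v := by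
  induction p generalizing u with
  | nil => rw [show u = v from h]
  | cons e p ih => rw [← h.1, component_o, ih h.2]

theorem IsPath.component_edge {p : List E} {u v : V} (h : Γ.IsPath u p v) {e : E} (he : e ∈ p) :
    Γ.component (Γ.o e) = Γ.component u := by
  induction p generalizing u with
  | nil => simp at he
  | cons e' p ih =>
    obtain ⟨rfl, h⟩ := h
    rcases List.mem_cons.mp he with rfl | he
    · rfl
    · rw [ih h he, component_o]

theorem exists_orientation [Finite E] : ∃ pos : E → Prop, ∀ e, pos (Γ.inv e) ↔ ¬ pos e := by
  obtain ⟨n, ⟨i⟩⟩ := Finite.exists_equiv_fin E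
  refine ⟨fun e => i e < i (Γ.inv e), fun e => ?_⟩
  beta_reduce
  rw [Γ.inv_inv, not_lt, le_iff_lt_or_eq]
  refine ⟨Or.inl, fun h => h.resolve_right fun h => Γ.inv_ne e (i.injective h)⟩

end SerreGraph

/-! ### Generators of the group attached to a potential -/

namespace Splitting

variable {C V E : Type*} {Δ : SerreGraph C E} {Γ : SerreGraph V E} {s : Splitting Δ Γ}
  {G : Type*} [Group G] {ν : E → G}

/-- The generators attached to a potential. -/
def Potential.gen (P : s.Potential ν) : E ⊕ C → G := s.gen ν P.dV P.dC

theorem Potential.gen_inl (P : s.Potential ν) (e : E) :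
    P.gen (.inl e) = P.dC (Δ.o e) * ν e * (P.dC (Δ.t e))⁻¹ := rfl

theorem Potential.gen_inr (P : s.Potential ν) (c : C) :
    P.gen (.inr c) = P.dV (s.proj c) * (P.dC c)⁻¹ := rfl

theorem Potential.gen_inv (P : s.Potential ν) (hν : Γ.IsVoltage ν) (e : E) :
    P.gen (.inl (Γ.inv e)) = (P.gen (.inl e))⁻¹ := by
  have h1 : Δ.t (Γ.inv e) = Δ.o e := by rw [← s.inv_eq, Δ.t_inv]
  have h2 : Δ.o (Γ.inv e) = Δ.t e := by rw [← s.inv_eq]; rfl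
  rw [gen_inl, gen_inl, h1, h2, hν]
  group

/-- The trivial edges contain a spanning forest of Δ, so constancy along them suffices. Giving m the
value `none` off K confines the condition to K. -/
theorem Potential.eq_of_component_eq (P : s.Potential ν) {X : Type*} (K : Δ.Component) (m : C → X)
    (hm : ∀ e, Δ.component (Δ.o e) = K → P.gen (.inl e) = 1 → m (Δ.o e) = m (Δ.t e))
    {c c' : C} (hc : Δ.component c = K) (hc' : Δ.component c' = K) : m c = m c' := by
  classical
  let m' : C → Option X := fun c => if Δ.component c = K then some (m c) else none
  have h1 : ∀ e, m' (Δ.o e) = m' (Δ.t e) := by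
    intro e
    refine congrArg (Quot.lift m' ?_) (P.forest e)
    rintro _ _ ⟨e, rfl, rfl, h⟩
    simp only [m', ← SerreGraph.component_o]
    split_ifs with hK
    · rw [hm e hK h]
    · rfl
  have h2 : m' c = m' c' := by
    have h3 : ∀ K' : Δ.Component, ∀ a b, Δ.component a = K' → Δ.component b = K' → m' a = m' b := by
      intro K' a b ha hb
      refine congrArg (Quot.lift m' ?_) (ha.trans hb.symm)
      rintro _ _ ⟨e, rfl, rfl⟩
      exact h1 e
    exact h3 K c c' hc hc'
  simpa [m', hc, hc'] using h2

/-- Contracting the new edges turns the enlarged graph into Γ. Arbitrary values ξ therefore give a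
voltage on Γ: go out along a new edge, across e, and back along a new edge. Universality realises it
up to coboundary. -/
theorem Potential.exists_twist.{w} (P : s.Potential ν)
    (hU : SerreGraph.IsUniversalVoltage.{w} Γ ν) {H : Type w} [Group H] (ξ : E ⊕ C → H)
    (hξ : ∀ e, ξ (.inl (Γ.inv e)) = (ξ (.inl e))⁻¹) :
    ∃ (θ : G →* H) (mV : V → H) (mC : C → H),
      (∀ e, θ (P.gen (.inl e)) = mC (Δ.o e) * ξ (.inl e) * (mC (Δ.t e))⁻¹) ∧
      ∀ c, θ (P.gen (.inr c)) = mV (s.proj c) * ξ (.inr c) * (mC c)⁻¹ := by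
  obtain ⟨θ, k, hk⟩ := hU H
    (fun e => ξ (.inr (Δ.o e)) * ξ (.inl e) * (ξ (.inr (Δ.t e)))⁻¹) (by
      intro e
      have h1 : Δ.t (Γ.inv e) = Δ.o e := by rw [← s.inv_eq, Δ.t_inv]
      have h2 : Δ.o (Γ.inv e) = Δ.t e := by rw [← s.inv_eq]; rfl
      simp only [h1, h2, hξ]
      group)
  refine ⟨θ, fun v => θ (P.dV v) * k v, fun c => θ (P.dC c) * k (s.proj c) * ξ (.inr c),
    fun e => ?_, fun c => ?_⟩
  · have h := hk e
    have h1 : θ (ν e) = k (Γ.o e) * (ξ (.inr (Δ.o e)) * ξ (.inl e) * (ξ (.inr (Δ.t e)))⁻¹) *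
        (k (Γ.t e))⁻¹ := by rw [h]; group
    beta_reduce
    rw [gen_inl, map_mul, map_mul, map_inv, h1, s.proj_o, s.proj_t]
    group
  · rw [gen_inr, map_mul, map_inv]
    group

/-- This is the freeness of G on the generators. When ξ respects the trivial ones, the twisting
functions are constant along the spanning tree, so the twist is a single conjugation and can be
undone. -/
theorem Potential.exists_hom (P : s.Potential ν) [Nonempty V]
    (hU : SerreGraph.IsUniversalVoltage.{0} Γ ν) {H : Type} [Group H] (ξ : E ⊕ C → H)
    (hξ : ∀ e, ξ (.inl (Γ.inv e)) = (ξ (.inl e))⁻¹) (h1 : ∀ z, P.gen z = 1 → ξ z = 1) :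
    ∃ θ : G →* H, ∀ z, θ (P.gen z) = ξ z := by
  obtain ⟨θ, mV, mC, hE, hC⟩ := P.exists_twist hU ξ hξ
  have hconst := P.tree mV mC
    (fun e he => by
      have h := hE e
      change P.gen _ = 1 at he
      rw [he, h1 _ he, map_one, mul_one] at h
      exact (mul_inv_eq_one.mp h.symm))
    (fun c hc => by
      have h := hC c
      change P.gen _ = 1 at hc
      rw [hc, h1 _ hc, map_one, mul_one] at h
      exact (mul_inv_eq_one.mp h.symm))
  obtain ⟨v⟩ := ‹Nonempty V›
  have hC' : ∀ c, mC c = mV v := fun c => (hconst v c).symm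
  have hV' : ∀ c, mV (s.proj c) = mV v := fun c => (hconst _ c).trans (hC' c)
  refine ⟨(MulAut.conj (mV v)⁻¹).toMonoidHom.comp θ, ?_⟩
  rintro (e | c)
  · simp only [MonoidHom.comp_apply, hE, hC']
    simp
    group
  · simp only [MonoidHom.comp_apply, hC, hC', hV']
    simp
    group

/-- Each edge of Γ is a new edge, an edge of Δ and a new edge reversed, and along a path the
potentials telescope. -/
theorem Potential.closure_range_gen (P : s.Potential ν)
    (hG : ∃ b, ∀ g, ∃ p, Γ.IsPath b p b ∧ volt ν p = g) :
    Subgroup.closure (Set.range P.gen) = ⊤ := by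
  obtain ⟨b, hb⟩ := hG
  have hz : ∀ z, P.gen z ∈ Subgroup.closure (Set.range P.gen) :=
    fun z => Subgroup.subset_closure ⟨z, rfl⟩
  have hpath : ∀ (p : List E) (u v : V), Γ.IsPath u p v →
      P.dV u * volt ν p * (P.dV v)⁻¹ ∈ Subgroup.closure (Set.range P.gen) := by
    intro p
    induction p with
    | nil => intro u v h; rw [show u = v from h]; simp
    | cons e p ih =>
      rintro u v ⟨rfl, h⟩
      have h1 := ih _ _ h
      have h2 := mul_mem (mul_mem (mul_mem (hz (.inr (Δ.o e))) (hz (.inl e)))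
        (inv_mem (hz (.inr (Δ.t e))))) h1
      rw [gen_inr, gen_inl, gen_inr, s.proj_o, s.proj_t] at h2
      rw [volt_cons]
      convert h2 using 1
      group
  rw [eq_top_iff]
  intro g _
  obtain ⟨p, hp, hpg⟩ := hb ((P.dV b)⁻¹ * g * P.dV b)
  have := hpath p b b hp
  rw [hpg] at this
  convert this using 1
  group

end Splitting

theorem hom_ext_of_closure {G H : Type*} [Group G] [Group H] {S : Set G}
    {f g : Subgroup.closure S →* H}
    (h : ∀ x (hx : x ∈ S), f ⟨x, Subgroup.subset_closure hx⟩ = g ⟨x, Subgroup.subset_closure hx⟩) :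
    f = g := by
  ext ⟨x, hx⟩
  induction hx using Subgroup.closure_induction with
  | mem x hx => exact h x hx
  | one => exact (map_one f).trans (map_one g).symm
  | mul x y hx hy ihx ihy =>
    have h1 : (⟨x * y, mul_mem hx hy⟩ : Subgroup.closure S) = ⟨x, hx⟩ * ⟨y, hy⟩ := rfl
    rw [h1, map_mul, map_mul, ihx, ihy]
  | inv x hx ih =>
    have h1 : (⟨x⁻¹, inv_mem hx⟩ : Subgroup.closure S) = ⟨x, hx⟩⁻¹ := rfl
    rw [h1, map_inv, map_inv, ih]

/-- Kill all the other factors. -/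
theorem IsFreeProduct.exists_retraction {G : Type*} [Group G] {k : ℕ} {A : Fin k → Subgroup G}
    {C : Subgroup G} (h : IsFreeProduct A C) (i : Fin k) :
    ∃ r : G →* A i, ∀ a : A i, r a = a := by
  classical
  let L := MulEquiv.ofBijective _ h
  let q : Monoid.Coprod (Monoid.CoprodI fun i => A i) C →* A i :=
    Monoid.Coprod.lift (Monoid.CoprodI.lift (Pi.mulSingle i (MonoidHom.id (A i)))) 1
  refine ⟨q.comp L.symm.toMonoidHom, fun a => ?_⟩
  have h1 : L (Monoid.Coprod.inl (Monoid.CoprodI.of a)) = a :=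
    (Monoid.Coprod.lift_apply_inl (Monoid.CoprodI.lift fun i => (A i).subtype) C.subtype _).trans
      (Monoid.CoprodI.lift_of (fun i => (A i).subtype) a)
  change q (L.symm a) = a
  rw [← h1, L.symm_apply_apply]
  simp [q]

/-- The map induced on connected components. -/
def CellMap.componentMap {C E : Type*} {Δ : SerreGraph C E} (g : CellMap Δ Δ) :
    Δ.Component → Δ.Component :=
  Quot.lift (fun c => Δ.component (g.vert c)) <| by
    rintro _ _ ⟨e, rfl, rfl⟩
    exact (g.isPath e).component_eq

theorem CellMap.iterate_componentMap {C E : Type*} {Δ : SerreGraph C E} (g : CellMap Δ Δ)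
    (n : ℕ) (c : C) : g.componentMap^[n] (Δ.component c) = Δ.component (g.vert^[n] c) := by
  induction n with
  | zero => rfl
  | succ n ih => rw [Function.iterate_succ_apply', Function.iterate_succ_apply', ih]; rfl

/-! ### Free factors from components, and the edge count -/

namespace Splitting

variable {C V E : Type*} {Δ : SerreGraph C E} {Γ : SerreGraph V E} {s : Splitting Δ Γ}

/-- A partition of the generators attached to a potential yields a free product decomposition. -/
theorem Potential.isFreeProduct {G : Type} [Group G] {ν : E → G} (P : s.Potential ν) [Nonempty V]
    (hν : Γ.IsVoltage ν)
    (hU : SerreGraph.IsUniversalVoltage.{0} Γ ν)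
    (hG : ∃ b, ∀ g, ∃ p, Γ.IsPath b p b ∧ volt ν p = g)
    {k : ℕ} (cl : E ⊕ C → Option (Fin k)) (hcl : ∀ e, cl (.inl (Γ.inv e)) = cl (.inl e)) :
    IsFreeProduct (fun i => Subgroup.closure (P.gen '' {z | cl z = some i}))
      (Subgroup.closure (P.gen '' {z | cl z = none})) := by
  let A : Fin k → Subgroup G := fun i => Subgroup.closure (P.gen '' {z | cl z = some i})
  let B : Subgroup G := Subgroup.closure (P.gen '' {z | cl z = none})
  have hA : ∀ z i, cl z = some i → P.gen z ∈ A i :=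
    fun z i h => Subgroup.subset_closure ⟨z, h, rfl⟩
  have hB : ∀ z, cl z = none → P.gen z ∈ B := fun z h => Subgroup.subset_closure ⟨z, h, rfl⟩
  let F := Monoid.Coprod (Monoid.CoprodI fun i => A i) B
  let L : F →* G := Monoid.Coprod.lift (Monoid.CoprodI.lift fun i => (A i).subtype) B.subtype
  change Function.Bijective L
  have hξ : ∀ z, ∃ y : F, L y = P.gen z ∧
      (∀ i (h : cl z = some i),
        y = Monoid.Coprod.inl (Monoid.CoprodI.of (i := i) (⟨P.gen z, hA z i h⟩ : A i))) ∧
      ∀ h : cl z = none, y = Monoid.Coprod.inr (⟨P.gen z, hB z h⟩ : B) := by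
    intro z
    obtain hz | ⟨i, hz⟩ := Option.eq_none_or_eq_some (cl z)
    · refine ⟨Monoid.Coprod.inr (⟨P.gen z, hB z hz⟩ : B), Monoid.Coprod.lift_apply_inr _ _ _,
        fun i h => absurd (hz.symm.trans h) (by simp), fun _ => rfl⟩
    · refine ⟨Monoid.Coprod.inl (Monoid.CoprodI.of (i := i) (⟨P.gen z, hA z i hz⟩ : A i)),
        (Monoid.Coprod.lift_apply_inl _ _ _).trans (Monoid.CoprodI.lift_of _ _), ?_,
        fun h => absurd (hz.symm.trans h) (by simp)⟩
      intro j hj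
      obtain rfl : i = j := Option.some.inj (hz.symm.trans hj)
      rfl
  choose ξ hξL hξA hξB using hξ
  -- Lifting each generator to its own factor defines a homomorphism to the abstract free product,
  -- which is the inverse of L.
  obtain ⟨θ, hθ⟩ := P.exists_hom hU ξ (by
    intro e
    rcases hz : cl (.inl e) with _ | i
    · rw [hξB _ hz, hξB _ ((hcl e).trans hz), ← map_inv]
      congr 1
      exact Subtype.ext (P.gen_inv hν e)
    · rw [hξA _ _ hz, hξA _ _ ((hcl e).trans hz), ← map_inv, ← map_inv]
      congr 2
      exact Subtype.ext (P.gen_inv hν e)) (by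
    intro z h1
    rcases hz : cl z with _ | i
    · rw [hξB _ hz, show (⟨P.gen z, hB z hz⟩ : B) = 1 from Subtype.ext h1, map_one]
    · rw [hξA _ _ hz, show (⟨P.gen z, hA z i hz⟩ : A i) = 1 from Subtype.ext h1, map_one, map_one])
  constructor
  · have h1 : θ.comp L = MonoidHom.id F := by
      apply Monoid.Coprod.hom_ext
      · apply Monoid.CoprodI.ext_hom
        intro i
        apply hom_ext_of_closure
        rintro _ ⟨z, hz, rfl⟩
        have h2 : θ (P.gen z) = _ := (hθ z).trans (hξA z i hz)
        simpa [L] using h2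
      · apply hom_ext_of_closure
        rintro _ ⟨z, hz, rfl⟩
        have h2 : θ (P.gen z) = _ := (hθ z).trans (hξB z hz)
        simpa [L] using h2
    exact Function.LeftInverse.injective (g := θ) fun y => DFunLike.congr_fun h1 y
  · rw [← MonoidHom.range_eq_top, eq_top_iff, ← P.closure_range_gen hG, Subgroup.closure_le]
    rintro _ ⟨z, rfl⟩
    exact ⟨_, hξL z⟩

variable {G : Type*} [Group G] {ν : E → G}

/-- The subgroup generated by the loops in a component of `Δ`, based along a potential. -/
def Potential.group (P : s.Potential ν) (K : Δ.Component) : Subgroup G :=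
  Subgroup.closure ((fun e => P.gen (.inl e)) '' {e | Δ.component (Δ.o e) = K})

theorem Potential.gen_mem_group (P : s.Potential ν) {K : Δ.Component} {e : E}
    (h : Δ.component (Δ.o e) = K) : P.gen (.inl e) ∈ P.group K :=
  Subgroup.subset_closure ⟨e, h, rfl⟩

theorem Potential.volt_mem_group (P : s.Potential ν) {p : List E} {c c' : C}
    (h : Δ.IsPath c p c') : P.dC c * volt ν p * (P.dC c')⁻¹ ∈ P.group (Δ.component c) := by
  induction p generalizing c with
  | nil => rw [show c = c' from h]; simp
  | cons e p ih =>
    obtain ⟨rfl, h⟩ := h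
    have h1 := ih h
    rw [← SerreGraph.component_o] at h1
    have h2 := mul_mem (P.gen_mem_group (e := e) rfl) h1
    rw [gen_inl] at h2
    rw [volt_cons]
    convert h2 using 1
    group

/-- An endomorphism of `G` that is induced by a map of `Δ` carries the group of a component into a
conjugate of the group of the image component. -/
theorem Potential.exists_conj_mem (P : s.Potential ν) (g : CellMap Δ Δ) (Φ : G →* G) (κ : V → G)
    (hκ : ∀ e, Φ (ν e) = κ (Γ.o e) * volt ν (g.edge e) * (κ (Γ.t e))⁻¹)
    (K : Δ.Component) :
    ∃ x : G, ∀ a ∈ P.group K, x⁻¹ * Φ a * x ∈ P.group (g.componentMap K) := by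
  obtain ⟨c₀, rfl⟩ := Quot.exists_rep K
  change ∃ x : G, ∀ a ∈ P.group (Δ.component c₀),
    x⁻¹ * Φ a * x ∈ P.group (Δ.component (g.vert c₀))
  let m : C → G := fun c => Φ (P.dC c) * κ (s.proj c) * (P.dC (g.vert c))⁻¹
  have hg : ∀ c c', Δ.component c = Δ.component c' →
      Δ.component (g.vert c) = Δ.component (g.vert c') :=
    fun c c' h => congrArg g.componentMap h
  have key : ∀ e, Φ (P.gen (.inl e)) = m (Δ.o e) *
      (P.dC (g.vert (Δ.o e)) * volt ν (g.edge e) * (P.dC (g.vert (Δ.t e)))⁻¹) *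
        (m (Δ.t e))⁻¹ := by
    intro e
    simp only [m]
    rw [gen_inl, map_mul, map_mul, map_inv, hκ, s.proj_o, s.proj_t]
    group
  have hmem : ∀ e, Δ.component (Δ.o e) = Δ.component c₀ →
      P.dC (g.vert (Δ.o e)) * volt ν (g.edge e) * (P.dC (g.vert (Δ.t e)))⁻¹ ∈
        P.group (Δ.component (g.vert c₀)) := by
    intro e he
    rw [← hg _ _ he]
    exact P.volt_mem_group (g.isPath e)
  -- On a trivial edge `key` says that m changes by an element of the target group. Its coset is
  -- thus constant on the component, and one conjugator `m c₀` serves all generators.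
  have hcoset : ∀ c, Δ.component c = Δ.component c₀ →
      (m c : G ⧸ P.group (Δ.component (g.vert c₀))) = m c₀ := by
    intro c hc
    refine P.eq_of_component_eq (Δ.component c₀)
      (fun c => (m c : G ⧸ P.group (Δ.component (g.vert c₀)))) ?_ hc rfl
    intro e he h1
    have h2 := key e
    rw [h1, map_one] at h2
    rw [QuotientGroup.eq]
    have h3 : (m (Δ.o e))⁻¹ * m (Δ.t e) =
        P.dC (g.vert (Δ.o e)) * volt ν (g.edge e) * (P.dC (g.vert (Δ.t e)))⁻¹ := by
      rw [eq_comm, mul_inv_eq_one] at h2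
      rw [← h2, inv_mul_cancel_left]
    rw [h3]
    exact hmem e he
  refine ⟨m c₀, fun a ha => ?_⟩
  have hle : P.group (Δ.component c₀) ≤ (P.group (Δ.component (g.vert c₀))).comap
      ((MulAut.conj (m c₀)⁻¹).toMonoidHom.comp Φ) := by
    unfold Potential.group
    rw [Subgroup.closure_le]
    rintro _ ⟨e, he, rfl⟩
    have h1 := QuotientGroup.eq.mp (hcoset _ he).symm
    have h2 := QuotientGroup.eq.mp (hcoset _ ((SerreGraph.component_o e).symm.trans he))
    have h3 := mul_mem (mul_mem h1 (hmem e he)) h2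
    change (MulAut.conj (m c₀)⁻¹) (Φ (P.gen (.inl e))) ∈ P.group (Δ.component (g.vert c₀))
    rw [key, MulAut.conj_apply]
    convert h3 using 1
    group
  simpa using hle ha

/-- If the group of a component is everything, then the rest of the graph is a forest attached to
this component, which bounds the number of its edges. -/
theorem Potential.card_le_of_group_eq_top [Finite C] [Finite V] [Finite E] (P : s.Potential ν)
    (hU : SerreGraph.IsUniversalVoltage.{0} Γ ν) (c₀ : C)
    (htop : P.group (Δ.component c₀) = ⊤) :
    Nat.card {e // Δ.component (Δ.o e) ≠ Δ.component c₀} +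
      2 * Nat.card {c // Δ.component c = Δ.component c₀} ≤ 2 * Nat.card V := by
  classical
  obtain ⟨pos, hpos⟩ := SerreGraph.exists_orientation (Γ := Γ)
  let K := Δ.component c₀
  let EP := {e // Δ.component (Δ.o e) ≠ K ∧ pos e}
  let CK := {c // Δ.component c = K}
  have hinv : ∀ e, Δ.component (Δ.o (Γ.inv e)) = Δ.component (Δ.o e) := by
    intro e
    rw [SerreGraph.component_o e, ← s.inv_eq]
    rfl
  obtain ⟨M, _, hM⟩ : ∃ (M : Type) (_ : CommGroup M), Nat.card M = 2 :=
    ⟨Multiplicative (ZMod 2), inferInstance, by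
      rw [Nat.card_congr Multiplicative.toAdd, Nat.card_zmod]⟩
  have : Finite M := Nat.finite_of_card_ne_zero (by omega)
  -- With M of order 2, surjectivity of Θ turns the bound into a comparison of exponents of 2. `EP`
  -- has one orientation of each edge outside K.
  let Θ : (V → M) → (EP → M) × (CK → M) := fun m =>
    (fun e => m (Γ.o e) * (m (Γ.t e))⁻¹, fun c => m (s.proj c))
  have hΘ : Function.Surjective Θ := by
    rintro ⟨a, b⟩
    let ξ : E ⊕ C → M := Sum.elim
      (fun e => if h : Δ.component (Δ.o e) = K then 1 else
        if hp : pos e then a ⟨e, h, hp⟩ else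
          (a ⟨Γ.inv e, by rwa [hinv], (hpos e).mpr hp⟩)⁻¹)
      (fun c => if h : Δ.component c = K then b ⟨c, h⟩ else 1)
    have hξ : ∀ e, ξ (.inl (Γ.inv e)) = (ξ (.inl e))⁻¹ := by
      intro e
      simp only [ξ, Sum.elim_inl, hinv, hpos, Γ.inv_inv]
      split_ifs <;> simp_all
    obtain ⟨θ, mV, mC, hE, hC⟩ := P.exists_twist hU ξ hξ
    have hmC : ∀ c, Δ.component c = K → mC c = mC c₀ := by
      intro c hc
      refine P.eq_of_component_eq K mC ?_ hc rfl
      intro e he h1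
      have h2 := hE e
      have h3 : ξ (.inl e) = 1 := dif_pos he
      rw [h1, map_one, h3, mul_one, eq_comm, mul_inv_eq_one] at h2
      exact h2
    -- As ξ is trivial on K, θ kills the group of K, which is everything. Hence ξ is a coboundary,
    -- and `mV` yields the required preimage.
    have hθ : ∀ x, θ x = 1 := by
      have h1 : P.group (Δ.component c₀) ≤ θ.ker := by
        unfold Potential.group
        rw [Subgroup.closure_le]
        rintro _ ⟨e, he, rfl⟩
        have h3 : ξ (.inl e) = 1 := dif_pos he
        change θ _ = 1
        rw [hE e, h3, hmC _ he, hmC _ ((SerreGraph.component_o e).symm.trans he)]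
        simp
      intro x
      exact h1 (htop ▸ Subgroup.mem_top x)
    have hVC : ∀ c, mV (s.proj c) * ξ (.inr c) = mC c := by
      intro c
      have h1 := hC c
      rw [hθ, eq_comm, mul_inv_eq_one] at h1
      exact h1
    refine ⟨fun v => (mV v)⁻¹ * mC c₀, Prod.ext (funext fun e => ?_) (funext fun c => ?_)⟩
    · have ho := hVC (Δ.o e.1)
      have ht := hVC (Δ.t e.1)
      have h1 : ξ (.inr (Δ.o e.1)) = 1 := dif_neg e.2.1
      have h2 : ξ (.inr (Δ.t e.1)) = 1 := dif_neg (by rw [← SerreGraph.component_o]; exact e.2.1)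
      have h3 : ξ (.inl e.1) = a e := (dif_neg e.2.1).trans (dif_pos e.2.2)
      rw [h1, mul_one, s.proj_o] at ho
      rw [h2, mul_one, s.proj_t] at ht
      have h4 := hE e.1
      rw [hθ, h3, ← ho, ← ht, eq_comm, mul_inv_eq_one] at h4
      simp only [Θ]
      rw [← h4]
      group
    · have h1 := hVC c
      have h2 : ξ (.inr c.1) = b c := dif_pos c.2
      rw [h2, hmC _ c.2] at h1
      simp only [Θ]
      rw [← h1, inv_mul_cancel_left]
  have hcard := Nat.card_le_card_of_surjective Θ hΘ
  rw [Nat.card_prod, Nat.card_fun, Nat.card_fun, Nat.card_fun, hM, ← pow_add] at hcard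
  have hle := (Nat.pow_le_pow_iff_right (by norm_num)).mp hcard
  have hEP : Nat.card {e // Δ.component (Δ.o e) ≠ K} = Nat.card (EP × Bool) := by
    refine Nat.card_congr ⟨fun e => if hp : pos e.1 then (⟨e.1, e.2, hp⟩, true) else
      (⟨Γ.inv e.1, by rw [hinv]; exact e.2, (hpos e.1).mpr hp⟩, false),
      fun x => if x.2 then ⟨x.1.1, x.1.2.1⟩ else ⟨Γ.inv x.1.1, by rw [hinv]; exact x.1.2.1⟩,
      ?_, ?_⟩
    · intro e
      by_cases hp : pos e.1 <;> simp [hp, Γ.inv_inv]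
    · rintro ⟨⟨e, he, hp⟩, b⟩
      cases b <;> simp [hp, hpos, Γ.inv_inv]
  have hbool : Nat.card Bool = 2 := by simp
  rw [hEP, Nat.card_prod, hbool]
  change _ * 2 + 2 * Nat.card CK ≤ _
  omega

/-- Count over each vertex v of Γ. A copy of v in K contributes 2; if there is none, all edges at v
lie outside K and contribute at least 3. Over the split vertex there is a surplus: a second copy in
K, or a copy outside K that has an edge. -/
theorem two_mul_card_lt [Finite C] [Finite V] [Finite E] (s : Splitting Δ Γ)
    (hdeg : ∀ v, 3 ≤ Γ.degree v) (K : Δ.Component) (hsurj : ∀ c, ∃ e, Δ.o e = c) {c₁ c₂ : C}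
    (hne : c₁ ≠ c₂) (hproj : s.proj c₁ = s.proj c₂) :
    2 * Nat.card V <
      Nat.card {e // Δ.component (Δ.o e) ≠ K} + 2 * Nat.card {c // Δ.component c = K} := by
  classical
  have := Fintype.ofFinite C
  have := Fintype.ofFinite V
  have := Fintype.ofFinite E
  let X := Finset.univ.filter fun e => Δ.component (Δ.o e) ≠ K
  let Y := Finset.univ.filter fun c => Δ.component c = K
  have hX : Nat.card {e // Δ.component (Δ.o e) ≠ K} = X.card := by
    rw [Nat.card_eq_fintype_card, Fintype.card_subtype]
  have hY : Nat.card {c // Δ.component c = K} = Y.card := by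
    rw [Nat.card_eq_fintype_card, Fintype.card_subtype]
  have hX' : X.card = ∑ v, (X.filter fun e => Γ.o e = v).card :=
    Finset.card_eq_sum_card_fiberwise fun _ _ => by simp
  have hY' : Y.card = ∑ v, (Y.filter fun c => s.proj c = v).card :=
    Finset.card_eq_sum_card_fiberwise fun _ _ => by simp
  have hV : 2 * Nat.card V = ∑ _v : V, 2 := by
    rw [Nat.card_eq_fintype_card]; simp [mul_comm]
  have hempty : ∀ v, (Y.filter fun c => s.proj c = v).card = 0 →
      3 ≤ (X.filter fun e => Γ.o e = v).card := by
    intro v h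
    have h1 : Γ.degree v = (X.filter fun e => Γ.o e = v).card := by
      rw [SerreGraph.degree, Nat.card_eq_fintype_card, Fintype.card_subtype]
      congr 1
      ext e
      simp only [Finset.mem_filter, Finset.mem_univ, true_and, X]
      refine ⟨fun he => ⟨fun hK => ?_, he⟩, fun he => he.2⟩
      rw [Finset.card_eq_zero] at h
      have h2 : Δ.o e ∈ (Y.filter fun c => s.proj c = v) := by
        simp [Y, hK, s.proj_o, he]
      rw [h] at h2
      simp at h2
    rw [← h1]
    exact hdeg v
  rw [hX, hY, hX', hY', hV, Finset.mul_sum, ← Finset.sum_add_distrib]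
  apply Finset.sum_lt_sum
  · intro v _
    rcases Nat.eq_zero_or_pos (Y.filter fun c => s.proj c = v).card with h | h
    · have := hempty v h; omega
    · omega
  · refine ⟨s.proj c₁, Finset.mem_univ _, ?_⟩
    rcases Nat.eq_zero_or_pos (Y.filter fun c => s.proj c = s.proj c₁).card with h | h
    · have := hempty _ h; omega
    · by_cases hc : Δ.component c₁ = K ∧ Δ.component c₂ = K
      · have h1 : 1 < (Y.filter fun c => s.proj c = s.proj c₁).card :=
          Finset.one_lt_card.mpr ⟨c₁, by simp [Y, hc.1], c₂, by simp [Y, hc.2, hproj], hne⟩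
        omega
      · obtain ⟨c, hcK, hcp⟩ : ∃ c, Δ.component c ≠ K ∧ s.proj c = s.proj c₁ := by
          by_cases h1 : Δ.component c₁ = K
          · exact ⟨c₂, fun h2 => hc ⟨h1, h2⟩, hproj.symm⟩
          · exact ⟨c₁, h1, rfl⟩
        obtain ⟨e, rfl⟩ := hsurj c
        have h1 : 0 < (X.filter fun e => Γ.o e = s.proj c₁).card :=
          Finset.card_pos.mpr ⟨e, by simp [X, hcK, ← hcp, s.proj_o]⟩
        omega

end Splitting

/-! ### Splitting a graph along Whitehead graphs -/

namespace CellMap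

variable {V E : Type*} {Γ : SerreGraph V E} (f : CellMap Γ Γ)

/-- Two edges with the same origin form a turn taken by `f`. -/
def TurnRel (e e' : E) : Prop := Γ.o e = Γ.o e' ∧ f.TurnTaken e e'

/-- The graph obtained from `Γ` by splitting each vertex into the components of its Whitehead
graph. -/
def splitGraph : SerreGraph (Quot f.TurnRel) E where
  o := Quot.mk _
  inv := Γ.inv
  inv_inv := Γ.inv_inv
  inv_ne := Γ.inv_ne

/-- Gluing back the vertices of `f.splitGraph`. -/
def splitting : Splitting f.splitGraph Γ where
  proj := Quot.lift Γ.o fun _ _ h => h.1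
  inv_eq _ := rfl
  proj_o _ := rfl

variable {f}

theorem iter_succ (n : ℕ) (e : E) : f.iter (n + 1) e = f.mapPath (f.iter n e) :=
  Function.iterate_succ_apply' _ _ _

theorem iter_one (e : E) : f.iter 1 e = f.edge e := by simp [iter, mapPath]

theorem o_head (hf : f.IsGraphMap) (e : E) : Γ.o ((f.edge e).head (hf e).1) = f.vert (Γ.o e) := by
  have h := f.isPath e
  rw [← List.cons_head_tail (hf e).1] at h
  exact h.1

/-- Apply f once more to the path that takes the turn: the images of the two edges meet in the image
turn. -/
theorem turnTaken_head (hf : f.IsGraphMap) {e e' : E} (h : f.TurnTaken e e') :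
    f.TurnTaken ((f.edge e).head (hf e).1) ((f.edge e').head (hf e').1) := by
  have key : ∀ (a b : E) (p : List E), [Γ.inv a, b] <:+: p →
      [Γ.inv ((f.edge a).head (hf a).1), (f.edge b).head (hf b).1] <:+: f.mapPath p := by
    rintro a b _ ⟨s, t, rfl⟩
    have ha : f.edge (Γ.inv a) = Γ.invPath (f.edge a).tail ++ [Γ.inv ((f.edge a).head (hf a).1)] := by
      rw [f.edge_inv]
      exact (congrArg Γ.invPath (List.cons_head_tail (hf a).1).symm).trans
        (Γ.invPath_append [_] _)
    refine ⟨f.mapPath s ++ Γ.invPath (f.edge a).tail, (f.edge b).tail ++ f.mapPath t, ?_⟩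
    have h1 : f.mapPath (s ++ [Γ.inv a, b] ++ t) =
        f.mapPath s ++ f.edge (Γ.inv a) ++ f.edge b ++ f.mapPath t := by simp [mapPath]
    rw [h1, ha]
    simp only [List.append_assoc, List.cons_append, List.nil_append]
    rw [← List.cons_append, List.cons_head_tail]
  obtain ⟨e₀, n, hn, h⟩ := h
  refine ⟨e₀, n + 1, by omega, ?_⟩
  rw [iter_succ]
  exact h.imp (key _ _ _) (key _ _ _)

theorem turnRel_of_infix_edge {e a b : E} (h : [a, b] <:+: f.edge e) :
    f.TurnRel (Γ.inv a) b := by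
  refine ⟨?_, e, 1, le_rfl, Or.inl ?_⟩
  · obtain ⟨s, t, hst⟩ := h
    have h1 := f.isPath e
    rw [← hst, List.append_assoc, SerreGraph.isPath_append_iff] at h1
    obtain ⟨v, -, h2⟩ := h1
    exact h2.2.1.symm
  · rwa [Γ.inv_inv, iter_one]

theorem isPath_splitGraph {p : List E} (hne : p ≠ [])
    (h : ∀ a b, [a, b] <:+: p → f.TurnRel (Γ.inv a) b) :
    f.splitGraph.IsPath (Quot.mk _ (p.head hne)) p (Quot.mk _ (Γ.inv (p.getLast hne))) := by
  induction p with
  | nil => exact absurd rfl hne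
  | cons a p ih =>
    cases p with
    | nil => exact ⟨rfl, rfl⟩
    | cons b p =>
      refine ⟨rfl, ?_⟩
      have h1 := ih (by simp) fun x y hxy => h x y (hxy.trans (List.suffix_cons _ _).isInfix)
      have h2 : f.splitGraph.t a = Quot.mk _ b := Quot.sound (h a b ⟨[], p, rfl⟩)
      rw [h2, List.getLast_cons (by simp)]
      exact h1

variable (f) in
/-- The lift of `f` to the split graph. -/
def splitMap (hf : f.IsGraphMap) : CellMap f.splitGraph f.splitGraph where
  vert := Quot.map (fun e => (f.edge e).head (hf e).1) fun e e' h =>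
    ⟨by rw [o_head hf, o_head hf, h.1], turnTaken_head hf h.2⟩
  edge := f.edge
  isPath e := by
    have h := isPath_splitGraph (hf e).1 fun a b => turnRel_of_infix_edge (e := e)
    have h1 : Γ.inv ((f.edge e).getLast (hf e).1) =
        (f.edge (Γ.inv e)).head (hf (Γ.inv e)).1 := by
      simp [f.edge_inv, SerreGraph.invPath, List.head_reverse]
    rw [h1] at h
    exact h
  edge_inv := f.edge_inv

/-- In particular f^n(e) stays within one component of the split graph. -/
theorem isPath_iter (hf : f.IsGraphMap) (n : ℕ) (e : E) :
    f.splitGraph.IsPath ((f.splitMap hf).vert^[n] (Quot.mk _ e)) (f.iter n e)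
      ((f.splitMap hf).vert^[n] (Quot.mk _ (Γ.inv e))) := by
  induction n with
  | zero => exact ⟨rfl, rfl⟩
  | succ n ih =>
    rw [Function.iterate_succ_apply', Function.iterate_succ_apply', iter_succ]
    exact (f.splitMap hf).isPath_mapPath ih

/-- The vertices of the split graph over u are the components of the Whitehead graph at u. The edge
at u is needed because `Connected` also fails for an empty graph. -/
theorem exists_ne_of_not_connected {u : V} (hu : ∃ e, Γ.o e = u)
    (h : ¬ (f.whiteheadGraph u).Connected) :
    ∃ a b, Γ.o a = u ∧ Γ.o b = u ∧ Quot.mk f.TurnRel a ≠ Quot.mk f.TurnRel b := by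
  classical
  by_contra! hall
  apply h
  obtain ⟨e, he⟩ := hu
  have : Nonempty {e // Γ.o e = u} := ⟨⟨e, he⟩⟩
  refine ⟨fun a b => ?_⟩
  let F : E → Option (f.whiteheadGraph u).ConnectedComponent := fun e =>
    if h : Γ.o e = u then some ((f.whiteheadGraph u).connectedComponentMk ⟨e, h⟩) else none
  have hF : ∀ e e', f.TurnRel e e' → F e = F e' := by
    rintro e e' ⟨ho, ht⟩
    by_cases h : Γ.o e = u
    · have h' : Γ.o e' = u := ho ▸ h
      simp only [F, dif_pos h, dif_pos h']
      congr 1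
      rw [SimpleGraph.ConnectedComponent.eq]
      by_cases hee : e = e'
      · subst hee; rfl
      · have hadj : (f.whiteheadGraph u).Adj ⟨e, h⟩ ⟨e', h'⟩ :=
          ⟨fun h => hee (congrArg Subtype.val h), ht⟩
        exact hadj.reachable
    · simp only [F, dif_neg h, dif_neg (ho ▸ h : ¬ Γ.o e' = u)]
  have h1 : F a = F b := congrArg (Quot.lift F hF) (hall a b a.2 b.2)
  simp only [F, dif_pos a.2, dif_pos b.2] at h1
  exact SimpleGraph.ConnectedComponent.exact (Option.some.inj h1)

end CellMap

/-- A self-map of a finite type permutes the forward orbit of some iterate of a given point. -/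
theorem exists_periodic_orbit {X : Type*} [Finite X] (T : X → X) (x : X) :
    ∃ (n k : ℕ) (y : Fin k → X) (σ : Equiv.Perm (Fin k)), Function.Injective y ∧
      (∀ i, y (σ i) = T (y i)) ∧ (∀ i, ∃ m, y i = T^[m] (T^[n] x)) ∧
      ∃ i, y i = T^[n] x := by
  classical
  obtain ⟨n, j, hnj, h⟩ : ∃ n j, n < j ∧ T^[n] x = T^[j] x := by
    obtain ⟨a, b, hab, h⟩ := Finite.exists_ne_map_eq_of_infinite fun n : ℕ => T^[n] x
    rcases lt_or_gt_of_ne hab with h' | h'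
    exacts [⟨a, b, h', h⟩, ⟨b, a, h', h.symm⟩]
  let S : Set X := Set.range fun m => T^[m] (T^[n] x)
  let τ : S → S := fun z => ⟨T z, by
    obtain ⟨_, m, rfl⟩ := z
    exact ⟨m + 1, Function.iterate_succ_apply' _ _ _⟩⟩
  have hτ : Function.Surjective τ := by
    rintro ⟨_, m, rfl⟩
    cases m with
    | zero =>
      -- The orbit returns to its starting point at time j, so the point one step earlier is a
      -- preimage.
      refine ⟨⟨_, j - n - 1, rfl⟩, Subtype.ext ?_⟩
      change T (T^[j - n - 1] (T^[n] x)) = T^[n] x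
      rw [← Function.iterate_succ_apply' T, ← Function.iterate_add_apply, h]
      congr 1
      omega
    | succ m => exact ⟨⟨_, m, rfl⟩, Subtype.ext (Function.iterate_succ_apply' _ _ _).symm⟩
  let τ' : Equiv.Perm S := Equiv.ofBijective τ ⟨Finite.injective_iff_surjective.mpr hτ, hτ⟩
  let ε := Finite.equivFin S
  refine ⟨n, Nat.card S, fun i => (ε.symm i).1, (ε.symm.trans τ').trans ε, ?_, ?_, ?_, ?_⟩
  · exact Subtype.val_injective.comp ε.symm.injective
  · intro i
    simp only [Equiv.trans_apply, Equiv.symm_apply_apply]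
    rfl
  · intro i
    obtain ⟨m, hm⟩ := (ε.symm i).2
    exact ⟨m, hm.symm⟩
  · exact ⟨ε ⟨_, 0, rfl⟩, congrArg Subtype.val (ε.symm_apply_apply _)⟩

/-! ### The main theorem -/

open CellMap in
theorem CellMap.IsTrainTrackRepresentative.isReducible {V E : Type*} [Finite V] [Finite E] {N : ℕ}
    {φ : Out (FreeGroup (Fin N))} {Γ : SerreGraph V E} {α : CellMap (rose N) Γ} {f : CellMap Γ Γ}
    (hf : IsTrainTrackRepresentative α f φ) (hexp : f.IsExpanding)
    (hWh : ∃ u : V, ¬ (f.whiteheadGraph u).Connected) : IsReducible φ := by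
  classical
  obtain ⟨β, hβ⟩ := hf.marking
  obtain ⟨Φ, hΦφ, hΦ⟩ := hf.induces β hβ
  obtain ⟨u, hu⟩ := hWh
  obtain ⟨e₀, he₀⟩ := hexp
  have : Nonempty V := ⟨u⟩
  have hdeg := hf.three_le_degree
  let Δ := f.splitGraph
  let s : Splitting Δ Γ := f.splitting
  let g : CellMap Δ Δ := f.splitMap hf.graphMap
  let ν := markVolt β
  have hν : Γ.IsVoltage ν := isVoltage_markVolt β
  have hU : SerreGraph.IsUniversalVoltage.{0} Γ ν := fun H _ l hl =>
    ⟨_, exists_eq_lift_markVolt hβ.2 hl⟩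
  obtain ⟨κ, hκ⟩ := exists_eq_lift_markVolt hβ.2 (f.isVoltage_comp hν)
  have hκ' : ∀ e, Φ.toMonoidHom (ν e) =
      κ (Γ.o e) * volt ν (g.edge e) * (κ (Γ.t e))⁻¹ := by
    intro e
    -- The homomorphism through which the pulled-back voltage factors agrees with Φ on the
    -- generators of F_N.
    have h1 : FreeGroup.lift (fun i => volt (fun e => volt ν (f.edge e)) (α.edge (i, true))) =
        Φ.toMonoidHom := by
      ext i
      have h2 := volt_markVolt β (f.mapPath (α.edge (i, true)))
      rw [f.volt_mapPath] at h2
      rw [FreeGroup.lift_apply_of]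
      exact h2.trans (hΦ i).symm
    have h2 := hκ e
    rw [h1] at h2
    change _ = κ (Γ.o e) * volt ν (f.edge e) * (κ (Γ.t e))⁻¹
    rw [h2]
    group
    rfl
  obtain ⟨P⟩ := s.nonempty_potential hf.connected ν
  have : Finite Δ.Component := Finite.of_surjective Δ.component Quot.mk_surjective
  obtain ⟨n, k, y, σ, hy, hσ, hyT, i₀, hi₀⟩ :=
    exists_periodic_orbit g.componentMap (Δ.component (Quot.mk _ e₀))
  choose x hx using fun i => P.exists_conj_mem g Φ.toMonoidHom κ hκ' (y i)
  -- Edges in a periodic component go to its factor. All new edges and the remaining edges go to the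
  -- complement.
  let cl : E ⊕ Quot f.TurnRel → Option (Fin k) := Sum.elim
    (fun e => if h : ∃ i, Δ.component (Δ.o e) = y i then some h.choose else none) fun _ => none
  have hcl : ∀ e i, cl (.inl e) = some i ↔ Δ.component (Δ.o e) = y i := by
    intro e i
    by_cases h : ∃ i, Δ.component (Δ.o e) = y i
    · have h1 : cl (.inl e) = some h.choose := dif_pos h
      rw [h1, Option.some.injEq]
      refine ⟨fun h2 => h2 ▸ h.choose_spec, fun h2 => hy (h.choose_spec.symm.trans h2)⟩
    · have h1 : cl (.inl e) = none := dif_neg h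
      rw [h1]
      exact ⟨fun h2 => by simp at h2, fun h2 => absurd ⟨i, h2⟩ h⟩
  have hcl_inv : ∀ e, cl (.inl (Γ.inv e)) = cl (.inl e) := by
    intro e
    have h1 : Δ.component (Δ.o (Γ.inv e)) = Δ.component (Δ.o e) :=
      (SerreGraph.component_o (Γ := Δ) e).symm
    simp only [cl, Sum.elim_inl, h1]
  have hfree := P.isFreeProduct hν hU ⟨_, exists_loop_volt_eq hβ.1⟩ cl hcl_inv
  have hA : ∀ i, Subgroup.closure (P.gen '' {z | cl z = some i}) = P.group (y i) := by
    intro i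
    unfold Splitting.Potential.group
    congr 1
    ext a
    constructor
    · rintro ⟨e | c, h, rfl⟩
      · exact ⟨e, (hcl e i).mp h, rfl⟩
      · simp [cl] at h
    · rintro ⟨e, h, rfl⟩
      exact ⟨.inl e, (hcl e i).mpr h, rfl⟩
  simp only [hA] at hfree
  choose r hr using hfree.exists_retraction
  have hfin : ∀ n, Finite (FreeGroup (Fin N) →* Equiv.Perm (Fin n)) := fun n =>
    Finite.of_equiv _ FreeGroup.lift
  have hmap := map_eq_of_map_le_conj hfin (fun _ => FreeGroup.exists_hom_perm_ne_one)
    (fun i => P.group (y i)) r hr Φ σ x (by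
      intro i a ha
      rw [hσ]
      exact hx i a ha)
  have hbot : ∀ i, P.group (y i) ≠ ⊥ := by
    intro i hi
    -- Triviality spreads forward along the cycle, so it reaches the component of f^q(e₀) for large
    -- q.
    have hnext : ∀ j, P.group (y j) = ⊥ → P.group (y (σ j)) = ⊥ := by
      intro j hj
      have h1 := hmap j
      simp only [hj, Subgroup.map_bot] at h1
      exact (Subgroup.map_eq_bot_iff_of_injective _ (MulAut.conj (x j)).injective).mp h1.symm
    obtain ⟨m, hm⟩ := hyT i
    have hiter : ∀ q, ∃ j, y j = g.componentMap^[q] (y i) ∧ P.group (y j) = ⊥ := by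
      intro q
      induction q with
      | zero => exact ⟨i, rfl, hi⟩
      | succ q ih =>
        obtain ⟨j, hj, hj'⟩ := ih
        exact ⟨σ j, by rw [hσ, hj, Function.iterate_succ_apply'], hnext j hj'⟩
    obtain ⟨q, hqn, hq⟩ := ((Filter.eventually_ge_atTop (n + m + 1)).and
      (he₀.eventually_gt_atTop (Nat.card (Quot f.TurnRel)))).exists
    obtain ⟨j, hj, hj'⟩ := hiter (q - n - m)
    -- Universality is needed again in the universe of E, since `tightVolt` takes values in
    -- `FreeGroup E`.
    have hU' : SerreGraph.IsUniversalVoltage Γ ν := fun H _ l hl =>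
      ⟨_, exists_eq_lift_markVolt hβ.2 hl⟩
    have hpath := isPath_iter hf.graphMap q e₀
    refine hq.not_ge (hU'.length_le_of_trivial s P.dC hpath
      (hf.trainTrack.2 e₀ q (by omega)) fun e he => ?_)
    have h1 : Δ.component (Δ.o e) = y j := by
      rw [hpath.component_edge he, hj, hm, ← Function.iterate_add_apply,
        ← Function.iterate_add_apply, g.iterate_componentMap,
        show q - n - m + m + n = q by omega]
    have h2 := P.gen_mem_group h1
    rw [hj', Subgroup.mem_bot] at h2
    exact h2
  have htop : ∀ i, P.group (y i) ≠ ⊤ := by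
    intro i hi
    have hsurj : ∀ v, ∃ e, Γ.o e = v := by
      intro v
      by_contra! h
      have : IsEmpty {e // Γ.o e = v} := ⟨fun e => h e.1 e.2⟩
      have := hdeg v
      simp [SerreGraph.degree] at this
    obtain ⟨a, b, ha, hb, hab⟩ := exists_ne_of_not_connected (hsurj u) hu
    obtain ⟨c, hc⟩ := Quot.exists_rep (y i)
    have hc' : Δ.component c = y i := hc
    rw [← hc'] at hi
    have h1 := P.card_le_of_group_eq_top hU c hi
    exact absurd (Splitting.two_mul_card_lt s hdeg (Δ.component c) Quot.exists_rep hab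
      (ha.trans hb.symm)) h1.not_gt
  refine ⟨k, fun i => P.group (y i), _, ?_, hfree, fun i => ⟨hbot i, htop i⟩, Φ, σ, hΦφ,
    fun i => ⟨x i, hmap i⟩⟩
  exact Nat.one_le_iff_ne_zero.mpr fun h => (h ▸ i₀ : Fin 0).elim0

end TrainTrack

theorem proposition4p1 {V E : Type*} [Finite V] [Finite E] (N : ℕ) (hN : 2 ≤ N)
    (φ : TrainTrack.Out (FreeGroup (Fin N)))
    (Γ : TrainTrack.SerreGraph V E)
    (α : TrainTrack.CellMap (TrainTrack.rose N) Γ) (f : TrainTrack.CellMap Γ Γ)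
    (hf : TrainTrack.CellMap.IsTrainTrackRepresentative α f φ)
    (hexp : f.IsExpanding)
    (hWh : ∃ u : V, ¬ (f.whiteheadGraph u).Connected) :
    TrainTrack.IsReducible φ := by
  exact hf.isReducible hexp hWh
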